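/- Let $\mathbb M=(M,<,\dots)$ be an o-minimal structure, i.e. $<$ is a dense linear order without endpoints and every subset of $M$ definable with parameters is a finite union of points and open intervals with endpoints in $M\cup\{\pm\infty\}$; "definable" means definable with parameters, and $M^n$ carries the product of the order topology. A definable space is a set $X$ with a finite cover by subsets $X_i$ and injections $\theta_i:X_i\to M^{n_i}$ such that each $\theta_i(X_i)$ is definable, each $\theta_i(X_i\cap X_j)$ is definable and open in $\theta_i(X_i)$, and the transition maps $\theta_i(X_i\cap X_j)\to\theta_j(X_i\cap X_j)$ are definable homeomorphisms. A subset $A\subseteq X$ is open (resp. definable) if every $\theta_i(A\cap X_i)$ is open in $\theta_i(X_i)$ (resp. definable). Definable subsets are definable spaces with the restricted charts, and products are definable spaces with the product charts. A map between definable spaces is definable if it is definable in the charts. A definable space is affine if it is definably homeomorphic to a definable subset of some $M^n$ with the induced topology. It is definably normal if any two disjoint closed definable subsets are contained in disjoint open definable subsets, and completely definably normal if each of its definable subspaces is definably normal. Let $\mathbb S$ be an elementary extension of $\mathbb M$ (resp. an o-minimal expansion of $\mathbb M$). In the first case $X(\mathbb S)$ denotes the $\mathbb S$-definable space obtained by gluing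 the sets $\theta_i(X_i)(\mathbb S)$ along the transition maps $\theta_{ij}^{\mathbb S}$, where $B(\mathbb S)$ is the set defined in $\mathbb S$ by a formula that defines $B$ in $\mathbb M$; in the second case $X(\mathbb S)$ is $X$ with the same charts, regarded as an $\mathbb S$-definable space. "$\mathbb S$-definably normal" is definable normality with respect to $\mathbb S$. A property $\mathcal P$ of pairs of definable spaces is affine on $(X,Y)$ if $\mathcal P$ holds on $(X,Y)$ whenever it holds on every pair $(C,D)$ of closed affine definable subspaces $C\subseteq X$, $D\subseteq Y$. Proposition. Let $X$ and $Y$ be definably normal definable spaces. Then each of the following properties is affine on $(X,Y)$: (1) $X\times Y$ is definably normal; (2) $X$ is completely definably normal; (3) $Y(\mathbb S)$ is $\mathbb S$-definably normal. Moreover, if $\mathbb M$ is an o-minimal expansion of an ordered group, then $X\times Y$ is definably normal, $X$ is completely definably normal, and $X(\mathbb S)$ is $\mathbb S$-definably normal. -/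

import Mathlib

open FirstOrder Topology

universe u v u' v' w w' x y

namespace OMin

/-- A subset of `M ^ α` is definable if it is defined by an `L`-formula with parameters from `M`. -/
abbrev DefSet (L : FirstOrder.Language.{u, v}) {M : Type w} [L.Structure M] {α : Type x}
    (B : Set (α → M)) : Prop :=
  (Set.univ : Set M).Definable L B

/-- Every definable subset of `M` is a finite union of points and of open intervals with endpoints
in `M ∪ {-∞, +∞}`. (Used for dense linear orders without endpoints.) -/
def IsOMinimal (L : FirstOrder.Language.{u, v}) (M : Type w) [L.Structure M] [LinearOrder M] : Prop :=
  ∀ B : Set M, (Set.univ : Set M).Definable₁ L B →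
    ∃ F : Set (Set M), F.Finite ∧ B = ⋃₀ F ∧
      ∀ I ∈ F, (∃ a, I = {a}) ∨ (∃ a b, I = Set.Ioo a b) ∨ (∃ a, I = Set.Ioi a) ∨
        (∃ a, I = Set.Iio a) ∨ I = Set.univ

/-- `M` carries a definable group operation, not assumed commutative, that makes it an
ordered group with respect to the given order. -/
def ExpandsOrderedGroup (L : FirstOrder.Language.{u, v}) (M : Type w) [L.Structure M] [LinearOrder M] :
    Prop :=
  ∃ _ : AddGroup M, (∀ a b c : M, a ≤ b → c + a ≤ c + b ∧ a + c ≤ b + c) ∧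
    DefSet L {p : Fin 3 → M | p 0 + p 1 = p 2}

/-- The underlying data of a space over `M` with finitely many charts: a set `carrier`, subsets
`dom i`, and maps `chart i : dom i → M ^ (dim i)`. The axioms of a definable space are
`ChartedSet.IsDefinableSpace` below. -/
structure ChartedSet (M : Type w) : Type (max w (x + 1)) where
  carrier : Type x
  ι : Type
  fin : Finite ι
  dim : ι → ℕ
  dom : ι → Set carrier
  chart : ∀ i, dom i → (Fin (dim i) → M)

namespace ChartedSet

variable {M : Type w}

/-- The image `θ_i(X_i)` of the `i`-th chart. -/
def img (X : ChartedSet.{w, x} M) (i : X.ι) : Set (Fin (X.dim i) → M) :=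
  Set.range (X.chart i)

/-- The set `θ_i(A ∩ X_i)`. -/
def imgOf (X : ChartedSet.{w, x} M) (A : Set X.carrier) (i : X.ι) : Set (Fin (X.dim i) → M) :=
  X.chart i '' {p | (p : X.carrier) ∈ A}

/-- The graph of the transition map `θ_j ∘ θ_i⁻¹ : θ_i(X_i ∩ X_j) → θ_j(X_i ∩ X_j)`. -/
def transGraph (X : ChartedSet.{w, x} M) (i j : X.ι) :
    Set (Fin (X.dim i) ⊕ Fin (X.dim j) → M) :=
  {p | ∃ (a : X.carrier) (hi : a ∈ X.dom i) (hj : a ∈ X.dom j),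
    p = Sum.elim (X.chart i ⟨a, hi⟩) (X.chart j ⟨a, hj⟩)}

/-- The axioms of a definable space: the charts are injective, cover the space and have definable
images; `θ_i(X_i ∩ X_j)` is definable and open in `θ_i(X_i)`; and the transition maps are definable
homeomorphisms. -/
structure IsDefinableSpace (L : FirstOrder.Language.{u, v}) [L.Structure M] [TopologicalSpace M]
    (X : ChartedSet.{w, x} M) : Prop where
  cover : ∀ a : X.carrier, ∃ i, a ∈ X.dom i
  inj : ∀ i, Function.Injective (X.chart i)
  img_def : ∀ i, DefSet L (X.img i)
  overlap_def : ∀ i j, DefSet L (X.imgOf (X.dom j) i)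
  overlap_open : ∀ i j, ∃ U : Set (Fin (X.dim i) → M), IsOpen U ∧
    X.imgOf (X.dom j) i = U ∩ X.img i
  trans_def : ∀ i j, DefSet L (X.transGraph i j)
  trans_homeo : ∀ i j, ∃ h : X.imgOf (X.dom j) i ≃ₜ X.imgOf (X.dom i) j,
    ∀ p : X.imgOf (X.dom j) i, Sum.elim (p : Fin (X.dim i) → M) (h p : Fin (X.dim j) → M) ∈ X.transGraph i j

/-- The topology of a definable space: `U` is open if and only if, for each `i`, the set
`θ_i(U ∩ X_i)` is open in `θ_i(X_i)` (see `isOpen_top_iff`). -/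
@[reducible] def top [TopologicalSpace M] (X : ChartedSet.{w, x} M) : TopologicalSpace X.carrier :=
  ⨆ i, TopologicalSpace.coinduced (Subtype.val : X.dom i → X.carrier)
    (TopologicalSpace.induced (X.chart i) inferInstance)

theorem isOpen_top_iff [TopologicalSpace M] (X : ChartedSet.{w, x} M)
    (hinj : ∀ i, Function.Injective (X.chart i)) (U : Set X.carrier) :
    IsOpen[X.top] U ↔ ∀ i, ∃ V : Set (Fin (X.dim i) → M), IsOpen V ∧
      X.imgOf U i = V ∩ X.img i := by
  simp only [isOpen_iSup_iff, isOpen_coinduced, isOpen_induced_iff]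
  refine forall_congr' fun i => exists_congr fun V => and_congr_right fun _ => ?_
  constructor
  · intro h
    ext z
    constructor
    · rintro ⟨p, hp, rfl⟩
      have hp' : p ∈ X.chart i ⁻¹' V := by rw [h]; exact hp
      exact ⟨hp', p, rfl⟩
    · rintro ⟨hz, p, rfl⟩
      have hp' : p ∈ X.chart i ⁻¹' V := hz
      rw [h] at hp'
      exact ⟨p, hp', rfl⟩
  · intro h
    ext p
    constructor
    · intro hp
      have hz : X.chart i p ∈ X.imgOf U i := by rw [h]; exact ⟨hp, p, rfl⟩
      obtain ⟨q, hq, hqp⟩ := hz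
      rw [← hinj i hqp]
      exact hq
    · intro hp
      have hz : X.chart i p ∈ X.imgOf U i := ⟨p, hp, rfl⟩
      rw [h] at hz
      exact hz.1

/-- A subset `A` of `X` is definable if each `θ_i(A ∩ X_i)` is definable. -/
def IsDefSubset (L : FirstOrder.Language.{u, v}) [L.Structure M] (X : ChartedSet.{w, x} M)
    (A : Set X.carrier) : Prop :=
  ∀ i, DefSet L (X.imgOf A i)

/-- A definable subset as a space of its own, with the restricted charts. -/
def restrict (X : ChartedSet.{w, x} M) (A : Set X.carrier) : ChartedSet.{w, x} M where
  carrier := A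
  ι := X.ι
  fin := X.fin
  dim := X.dim
  dom i := {p | (p : X.carrier) ∈ X.dom i}
  chart i p := X.chart i ⟨p.1.1, p.2⟩

/-- The cartesian product, with the charts `θ_i × δ_j : X_i × Y_j → M ^ (n_i + m_j)`. -/
def prod (X : ChartedSet.{w, x} M) (Y : ChartedSet.{w, y} M) : ChartedSet.{w, max x y} M where
  carrier := X.carrier × Y.carrier
  ι := X.ι × Y.ι
  fin := by
    have := X.fin
    have := Y.fin
    infer_instance
  dim k := X.dim k.1 + Y.dim k.2
  dom k := {p | p.1 ∈ X.dom k.1 ∧ p.2 ∈ Y.dom k.2}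
  chart k p := Fin.append (X.chart k.1 ⟨p.1.1, p.2.1⟩) (Y.chart k.2 ⟨p.1.2, p.2.2⟩)

/-- A subset of `M ^ n` as a space with one chart. -/
def ofSet {n : ℕ} (B : Set (Fin n → M)) : ChartedSet.{w, w} M where
  carrier := B
  ι := Unit
  fin := inferInstance
  dim _ := n
  dom _ := Set.univ
  chart _ p := p.1.1

/-- Definable maps: each `δ_j ∘ f ∘ θ_i⁻¹`, on `θ_i(X_i ∩ f⁻¹(Y_j))`, has a definable graph. -/
def IsDefMap (L : FirstOrder.Language.{u, v}) [L.Structure M] (X : ChartedSet.{w, x} M)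
    (Y : ChartedSet.{w, y} M) (f : X.carrier → Y.carrier) : Prop :=
  ∀ i j, DefSet L {p : Fin (X.dim i) ⊕ Fin (Y.dim j) → M |
    ∃ (a : X.carrier) (hi : a ∈ X.dom i) (hj : f a ∈ Y.dom j),
      p = Sum.elim (X.chart i ⟨a, hi⟩) (Y.chart j ⟨f a, hj⟩)}

/-- `X` is affine: it is definably homeomorphic to a definable set with the induced topology. -/
def IsAffine (L : FirstOrder.Language.{u, v}) [L.Structure M] [TopologicalSpace M]
    (X : ChartedSet.{w, x} M) : Prop :=
  ∃ (n : ℕ) (B : Set (Fin n → M)) (e : X.carrier ≃ (ofSet B).carrier), DefSet L B ∧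
    Continuous[X.top, (ofSet B).top] e ∧ Continuous[(ofSet B).top, X.top] e.symm ∧
    IsDefMap L X (ofSet B) e ∧ IsDefMap L (ofSet B) X e.symm

/-- `X` is a definably normal definable space: disjoint closed definable subsets are separated by
disjoint open definable subsets. -/
def IsDefinablyNormal (L : FirstOrder.Language.{u, v}) [L.Structure M] [TopologicalSpace M]
    (X : ChartedSet.{w, x} M) : Prop :=
  X.IsDefinableSpace L ∧
    ∀ Z₁ Z₂ : Set X.carrier, X.IsDefSubset L Z₁ → X.IsDefSubset L Z₂ →
      IsClosed[X.top] Z₁ → IsClosed[X.top] Z₂ → Disjoint Z₁ Z₂ →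
      ∃ U₁ U₂ : Set X.carrier, X.IsDefSubset L U₁ ∧ X.IsDefSubset L U₂ ∧
        IsOpen[X.top] U₁ ∧ IsOpen[X.top] U₂ ∧ Disjoint U₁ U₂ ∧ Z₁ ⊆ U₁ ∧ Z₂ ⊆ U₂

/-- `X` is a completely definably normal definable space: every definable subset is a definably
normal definable subspace. -/
def IsCompletelyDefinablyNormal (L : FirstOrder.Language.{u, v}) [L.Structure M] [TopologicalSpace M]
    (X : ChartedSet.{w, x} M) : Prop :=
  X.IsDefinableSpace L ∧
    ∀ Z : Set X.carrier, X.IsDefSubset L Z → (X.restrict Z).IsDefinablyNormal L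

/-- `C` is a closed affine definable subspace of `X`. -/
def IsClosedAffine (L : FirstOrder.Language.{u, v}) [L.Structure M] [TopologicalSpace M]
    (X : ChartedSet.{w, x} M) (C : Set X.carrier) : Prop :=
  X.IsDefSubset L C ∧ IsClosed[X.top] C ∧ (X.restrict C).IsAffine L

/-- A property `P` of pairs of spaces is affine on `(X, Y)` if it holds on `(X, Y)` whenever it
holds on all pairs `(C, D)` of closed affine definable subspaces `C ⊆ X` and `D ⊆ Y`. -/
def AffineOn (L : FirstOrder.Language.{u, v}) [L.Structure M] [TopologicalSpace M]
    (X : ChartedSet.{w, x} M) (Y : ChartedSet.{w, y} M)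
    (P : ChartedSet.{w, x} M → ChartedSet.{w, y} M → Prop) : Prop :=
  (∀ (C : Set X.carrier) (D : Set Y.carrier), X.IsClosedAffine L C → Y.IsClosedAffine L D →
    P (X.restrict C) (Y.restrict D)) → P X Y

end ChartedSet

/-- For an elementary extension `f : M → S` and a definable `B ⊆ M ^ α`, the set `B(S) ⊆ S ^ α`
defined in `S` by the formulas with parameters in `M` that define `B` in `M`. (All such formulas
define the same subset of `S ^ α`.) -/
def extSet {L : FirstOrder.Language.{u, v}} {M : Type w} {S : Type w'} [L.Structure M] [L.Structure S]
    (f : M ↪ₑ[L] S) {α : Type x} (B : Set (α → M)) : Set (α → S) :=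
  {b | ∃ φ : L.Formula (M ⊕ α), (∀ a : α → M, a ∈ B ↔ φ.Realize (Sum.elim id a)) ∧
    φ.Realize (Sum.elim f b)}

/-- The space `X(S)`: the quotient of the disjoint union of the sets `θ_i(X_i)(S)` obtained by
gluing along the transition maps `θ_ij(S)`. The `i`-th chart domain is the image of
`θ_i(X_i)(S)`, and the `i`-th chart sends a point of it to its preimage in `θ_i(X_i)(S)` (which
is unique when `X` is a definable space). -/
noncomputable def ChartedSet.ext {L : FirstOrder.Language.{u, v}} {M : Type w} {S : Type w'} [L.Structure M]
    [L.Structure S] (f : M ↪ₑ[L] S) (X : ChartedSet.{w, x} M) : ChartedSet.{w', w'} S where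
  carrier := Quot fun a b : Σ i, extSet f (X.img i) =>
    Sum.elim (a.2 : Fin (X.dim a.1) → S) (b.2 : Fin (X.dim b.1) → S) ∈
      extSet f (X.transGraph a.1 b.1)
  ι := X.ι
  fin := X.fin
  dim := X.dim
  dom i := Set.range fun b : extSet f (X.img i) => Quot.mk _ ⟨i, b⟩
  chart _ p := (Classical.choose p.2).1

end OMin

/-! A definably normal space has a shrinking of its finite atlas: closed definable sets `C i ⊆ X.dom
i` that still cover (`SepNormal.exists_shrinking`). Each `C i` is affine, because a single chart
describes it completely (`isClosedAffine`).

Conversely, normality passes from a finite closed definable cover to the whole space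
(`SepNormal.of_closed_cover`). Separate the traces of the two closed sets on each piece by `U₁ k`
and `U₂ k`, and take the points which, for every piece containing them, lie in `U₁ k`, respectively
`U₂ k`. These sets are open because a closed subset of a closed piece is closed in the space. Hence
each affineness claim only needs a closed cover by suitable pieces: `C i × D j` for the product, `Z
∩ C i` for a definable subspace `Z`, `D i` in an expansion, and the extensions of the `D i` in an
elementary extension.

For the extension, the axioms of a definable space, the gluing relation and closedness are all
rewritten as first-order conditions on chart images and transition graphs, with open boxes in place
of open sets. `Transfers` builds the corresponding formulas by recursion on connectives and
quantifiers.

For ordered groups it remains to separate relatively closed definable sets inside one chart. This is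
done with balls of the gauge `z < a + ε ∧ a < z + ε`: around each point of `A` take a ball meeting
no ball of the same radius centred in `B`. The properties used form the first-order structure
`IsGauge`, so they survive in elementary extensions and expansions. -/

namespace OMin

open FirstOrder.Language

/-! ### Transfer of first-order statements, and definability as a special case. -/

section Transfer

variable {L : FirstOrder.Language.{u, v}} {M : Type w} {S : Type w'} [L.Structure M]
  [L.Structure S] {f : M ↪ₑ[L] S} {α : Type*} {β : Type*}

/-- A single formula with parameters from `M` defines `P` in `M` and `P'` in the elementary
extension `S`. -/
def Transfers (f : M ↪ₑ[L] S) (P : (α → M) → Prop) (P' : (α → S) → Prop) : Prop :=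
  ∃ φ : L.Formula (M ⊕ α), (∀ a, P a ↔ φ.Realize (Sum.elim id a)) ∧
    ∀ b, P' b ↔ φ.Realize (Sum.elim f b)

namespace Transfers

variable {P Q : (α → M) → Prop} {P' Q' : (α → S) → Prop}

theorem not (h : Transfers f P P') : Transfers f (fun a => ¬ P a) (fun b => ¬ P' b) := by
  obtain ⟨φ, h₁, h₂⟩ := h
  exact ⟨φ.not, by simp [h₁], by simp [h₂]⟩

theorem and (h : Transfers f P P') (k : Transfers f Q Q') :
    Transfers f (fun a => P a ∧ Q a) (fun b => P' b ∧ Q' b) := by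
  obtain ⟨φ, h₁, h₂⟩ := h
  obtain ⟨ψ, k₁, k₂⟩ := k
  exact ⟨φ ⊓ ψ, by simp [h₁, k₁], by simp [h₂, k₂]⟩

theorem imp (h : Transfers f P P') (k : Transfers f Q Q') :
    Transfers f (fun a => P a → Q a) (fun b => P' b → Q' b) := by
  obtain ⟨φ, h₁, h₂⟩ := h
  obtain ⟨ψ, k₁, k₂⟩ := k
  exact ⟨φ.imp ψ, by simp [h₁, k₁], by simp [h₂, k₂]⟩

theorem iff (h : Transfers f P P') (k : Transfers f Q Q') :
    Transfers f (fun a => P a ↔ Q a) (fun b => P' b ↔ Q' b) := by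
  obtain ⟨φ, h₁, h₂⟩ := h
  obtain ⟨ψ, k₁, k₂⟩ := k
  exact ⟨Formula.iff φ ψ, by simp [h₁, k₁], by simp [h₂, k₂]⟩

theorem forall_index {ι : Type*} [Finite ι] {P : ι → (α → M) → Prop} {P' : ι → (α → S) → Prop}
    (h : ∀ i, Transfers f (P i) (P' i)) :
    Transfers f (fun a => ∀ i, P i a) (fun b => ∀ i, P' i b) := by
  choose φ h₁ h₂ using h
  exact ⟨Formula.iInf φ, by simp [h₁], by simp [h₂]⟩

theorem exists_index {ι : Type*} [Finite ι] {P : ι → (α → M) → Prop} {P' : ι → (α → S) → Prop}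
    (h : ∀ i, Transfers f (P i) (P' i)) :
    Transfers f (fun a => ∃ i, P i a) (fun b => ∃ i, P' i b) := by
  choose φ h₁ h₂ using h
  exact ⟨Formula.iSup φ, by simp [h₁], by simp [h₂]⟩

theorem ex [Finite β] {P : (α → M) → (β → M) → Prop} {P' : (α → S) → (β → S) → Prop}
    (h : Transfers f (fun a : α ⊕ β → M => P (fun i => a (Sum.inl i)) (fun i => a (Sum.inr i)))
      (fun a => P' (fun i => a (Sum.inl i)) (fun i => a (Sum.inr i)))) :
    Transfers f (fun a => ∃ b, P a b) (fun a => ∃ b, P' a b) := by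
  obtain ⟨φ, h₁, h₂⟩ := h
  -- Reassociation makes the block `β` the right summand, the one that `iExs` quantifies.
  refine ⟨(φ.relabel (Equiv.sumAssoc M α β).symm).iExs β, fun a => ?_, fun a => ?_⟩
  · rw [Formula.realize_iExs]
    refine exists_congr fun b => ?_
    rw [Formula.realize_relabel]
    refine (h₁ (Sum.elim a b)).trans (iff_of_eq (congrArg _ ?_))
    ext (i | i | i) <;> rfl
  · rw [Formula.realize_iExs]
    refine exists_congr fun b => ?_
    rw [Formula.realize_relabel]
    refine (h₂ (Sum.elim a b)).trans (iff_of_eq (congrArg _ ?_))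
    ext (i | i | i) <;> rfl

theorem congr {P₁ : (α → M) → Prop} {P₁' : (α → S) → Prop} (h : Transfers f P P')
    (k : ∀ a, P₁ a ↔ P a) (k' : ∀ a, P₁' a ↔ P' a) : Transfers f P₁ P₁' := by
  obtain ⟨φ, h₁, h₂⟩ := h
  exact ⟨φ, fun a => (k a).trans (h₁ a), fun a => (k' a).trans (h₂ a)⟩

theorem all [Finite β] {P : (α → M) → (β → M) → Prop} {P' : (α → S) → (β → S) → Prop}
    (h : Transfers f (fun a : α ⊕ β → M => P (fun i => a (Sum.inl i)) (fun i => a (Sum.inr i)))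
      (fun a => P' (fun i => a (Sum.inl i)) (fun i => a (Sum.inr i)))) :
    Transfers f (fun a => ∀ b, P a b) (fun a => ∀ b, P' a b) :=
  congr (P := fun a => ¬ ∃ b, ¬ P a b) (P' := fun a => ¬ ∃ b, ¬ P' a b) h.not.ex.not
    (by simp) (by simp)

theorem comp {γ : Type*} (s : α → γ) (h : Transfers f P P') :
    Transfers f (fun a : γ → M => P (fun i => a (s i))) (fun b => P' (fun i => b (s i))) := by
  obtain ⟨φ, h₁, h₂⟩ := h
  refine ⟨φ.relabel (Sum.map id s), fun a => ?_, fun a => ?_⟩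
  · rw [Formula.realize_relabel]
    refine (h₁ _).trans <| iff_of_eq (congrArg _ ?_)
    ext (i | i) <;> rfl
  · rw [Formula.realize_relabel]
    refine (h₂ _).trans <| iff_of_eq (congrArg _ ?_)
    ext (i | i) <;> rfl

theorem ex_one {P : (α → M) → M → Prop} {P' : (α → S) → S → Prop}
    (h : Transfers f (fun a : α ⊕ Unit → M => P (fun i => a (Sum.inl i)) (a (Sum.inr ())))
      (fun a => P' (fun i => a (Sum.inl i)) (a (Sum.inr ())))) :
    Transfers f (fun a => ∃ b, P a b) (fun a => ∃ b, P' a b) :=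
  congr (P := fun a => ∃ b : Unit → M, P a (b ())) (P' := fun a => ∃ b : Unit → S, P' a (b ()))
    h.ex (fun _ => ⟨fun ⟨b, hb⟩ => ⟨fun _ => b, hb⟩, fun ⟨b, hb⟩ => ⟨b (), hb⟩⟩)
    (fun _ => ⟨fun ⟨b, hb⟩ => ⟨fun _ => b, hb⟩, fun ⟨b, hb⟩ => ⟨b (), hb⟩⟩)

theorem all_one {P : (α → M) → M → Prop} {P' : (α → S) → S → Prop}
    (h : Transfers f (fun a : α ⊕ Unit → M => P (fun i => a (Sum.inl i)) (a (Sum.inr ())))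
      (fun a => P' (fun i => a (Sum.inl i)) (a (Sum.inr ())))) :
    Transfers f (fun a => ∀ b, P a b) (fun a => ∀ b, P' a b) :=
  congr (P := fun a => ¬ ∃ b, ¬ P a b) (P' := fun a => ¬ ∃ b, ¬ P' a b) h.not.ex_one.not
    (by simp) (by simp)

theorem comp_elim {γ α₁ α₂ : Type*} {P : (α₁ ⊕ α₂ → M) → Prop} {P' : (α₁ ⊕ α₂ → S) → Prop}
    (s : α₁ → γ) (t : α₂ → γ) (h : Transfers f P P') :
    Transfers f (fun a : γ → M => P (Sum.elim (fun i => a (s i)) (fun i => a (t i))))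
      (fun b => P' (Sum.elim (fun i => b (s i)) (fun i => b (t i)))) := by
  refine (h.comp (Sum.elim s t)).congr (fun a => iff_of_eq (congrArg _ ?_))
    (fun a => iff_of_eq (congrArg _ ?_)) <;> ext (i | i) <;> rfl

theorem comp_vec {γ : Type*} {P : (Fin 3 → M) → Prop} {P' : (Fin 3 → S) → Prop}
    (i j k : γ) (h : Transfers f P P') :
    Transfers f (fun a : γ → M => P ![a i, a j, a k]) (fun b => P' ![b i, b j, b k]) := by
  refine (h.comp ![i, j, k]).congr (fun a => iff_of_eq (congrArg _ ?_))
    (fun a => iff_of_eq (congrArg _ ?_)) <;> ext r <;> fin_cases r <;> rfl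

/-- Membership in a definable set, with the variables grouped in two blocks. -/
theorem mem_elim {γ α₁ α₂ : Type*} {B : Set (α₁ ⊕ α₂ → M)} {B' : Set (α₁ ⊕ α₂ → S)}
    (s : α₁ → γ) (t : α₂ → γ) (h : Transfers f (· ∈ B) (· ∈ B')) :
    Transfers f (fun a : γ → M => Sum.elim (fun i => a (s i)) (fun i => a (t i)) ∈ B)
      (fun b => Sum.elim (fun i => b (s i)) (fun i => b (t i)) ∈ B') :=
  comp_elim s t h

theorem mem_vec {γ : Type*} {B : Set (Fin 3 → M)} {B' : Set (Fin 3 → S)}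
    (i j k : γ) (h : Transfers f (· ∈ B) (· ∈ B')) :
    Transfers f (fun a : γ → M => ![a i, a j, a k] ∈ B) (fun b => ![b i, b j, b k] ∈ B') :=
  comp_vec i j k h

theorem mem {γ : Type*} {B : Set (α → M)} {B' : Set (α → S)}
    (s : α → γ) (h : Transfers f (· ∈ B) (· ∈ B')) :
    Transfers f (fun a : γ → M => (fun i => a (s i)) ∈ B) (fun b => (fun i => b (s i)) ∈ B') :=
  comp s h

/-- Elementarity of `f` enters here directly; the other transfer results are derived from this one.
-/
theorem iff_map (h : Transfers f P P') (a : α → M) : P a ↔ P' (fun i => f (a i)) := by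
  obtain ⟨φ, h₁, h₂⟩ := h
  rw [h₁, h₂, ← f.map_formula]
  refine iff_of_eq (congrArg _ ?_)
  ext (i | i) <;> rfl

theorem forall_iff [Finite α] (h : Transfers f P P') : (∀ a, P a) ↔ ∀ b, P' b :=
  iff_map (α := Empty) (P := fun _ => ∀ a, P a) (P' := fun _ => ∀ a, P' a)
    (all (h.comp Sum.inr)) Empty.elim

theorem sentence_iff {p p' : Prop} (h : Transfers f (fun _ : Empty → M => p) (fun _ => p')) :
    p ↔ p' :=
  h.iff_map Empty.elim

/-- Equivalence of two formulas is itself a sentence with parameters in `M`. This makes the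
extension of a definable set independent of the defining formula. -/
theorem subst (h : Transfers f P P') (k : Transfers f P Q') [Finite α] (b : α → S) :
    P' b ↔ Q' b :=
  (forall_iff (h.iff k)).1 (fun _ => Iff.rfl) b

theorem eq (i j : α) : Transfers f (fun a => a i = a j) (fun b => b i = b j) :=
  ⟨((Term.var (Sum.inr i)).equal (Term.var (Sum.inr j)) : L.Formula (M ⊕ α)),
    by simp [Formula.realize_equal], by simp [Formula.realize_equal]⟩

theorem eq_block [Finite β] (s t : β → α) :
    Transfers f (fun a => (fun i => a (s i)) = fun i => a (t i))
      (fun b => (fun i => b (s i)) = fun i => b (t i)) :=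
  (forall_index fun i => eq (s i) (t i)).congr (fun _ => funext_iff) (fun _ => funext_iff)

theorem le [L.IsOrdered] [LE M] [LE S] [L.OrderedStructure M] [L.OrderedStructure S] (i j : α) :
    Transfers f (fun a => a i ≤ a j) (fun b => b i ≤ b j) :=
  ⟨(leSymb.formula₂ (Term.var (Sum.inr i)) (Term.var (Sum.inr j)) : L.Formula (M ⊕ α)),
    by simp [Formula.realize_rel₂, relMap_leSymb], by simp [Formula.realize_rel₂, relMap_leSymb]⟩

theorem lt [L.IsOrdered] [LinearOrder M] [LinearOrder S] [L.OrderedStructure M]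
    [L.OrderedStructure S] (i j : α) :
    Transfers f (fun a => a i < a j) (fun b => b i < b j) :=
  (le j i).not.congr (fun _ => not_le.symm) (fun _ => not_le.symm)

theorem defSet_left (h : Transfers f P P') : DefSet L {a | P a} := by
  obtain ⟨φ, h₁, -⟩ := h
  refine Set.definable_iff_exists_formula_sum.2
    ⟨φ.relabel (Sum.map (fun m => ⟨m, trivial⟩) id), ?_⟩
  ext a
  simp only [Set.mem_ofPred_eq, Formula.realize_relabel, h₁]
  refine iff_of_eq (congrArg _ ?_)
  ext (i | i) <;> rfl

theorem defSet_right (h : Transfers f P P') : DefSet L {b | P' b} := by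
  obtain ⟨φ, -, h₂⟩ := h
  refine Set.definable_iff_exists_formula_sum.2
    ⟨φ.relabel (Sum.map (fun m => ⟨f m, trivial⟩) id), ?_⟩
  ext a
  simp only [Set.mem_ofPred_eq, Formula.realize_relabel, h₂]
  refine iff_of_eq (congrArg _ ?_)
  ext (i | i) <;> rfl

end Transfers

/-- `extSet` quantifies over all defining formulas; by `subst` any one of them already decides
membership. -/
theorem transfers_extSet [Finite α] {B : Set (α → M)} (h : DefSet L B) :
    Transfers f (· ∈ B) (· ∈ extSet f B) := by
  obtain ⟨φ, rfl⟩ := Set.definable_iff_exists_formula_sum.1 h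
  have key : ∀ a : α → M, (φ.Realize (Sum.elim (↑) a) ↔
      (φ.relabel (Sum.map Subtype.val id) : L.Formula (M ⊕ α)).Realize (Sum.elim id a)) := by
    intro a
    rw [Formula.realize_relabel]
    refine iff_of_eq (congrArg _ ?_)
    ext (i | i) <;> rfl
  refine ⟨φ.relabel (Sum.map Subtype.val id), key, fun b => ⟨?_, fun hb => ⟨_, key, hb⟩⟩⟩
  rintro ⟨ψ, h₁, h₂⟩
  exact (Transfers.subst ⟨ψ, h₁, fun _ => Iff.rfl⟩ ⟨_, key, fun _ => Iff.rfl⟩ b).1 h₂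

/-- For the identity embedding the closure rules of `Transfers` become closure rules for definable
sets, so definability is proved below by the same combinators. -/
theorem defSet_iff_transfers {B : Set (α → M)} :
    DefSet L B ↔ Transfers (ElementaryEmbedding.refl L M) (· ∈ B) (· ∈ B) := by
  refine ⟨fun h => ?_, fun h => h.defSet_left⟩
  obtain ⟨φ, rfl⟩ := Set.definable_iff_exists_formula_sum.1 h
  have key : ∀ a : α → M, (φ.Realize (Sum.elim (↑) a) ↔
      (φ.relabel (Sum.map Subtype.val id) : L.Formula (M ⊕ α)).Realize (Sum.elim id a)) := by
    intro a
    rw [Formula.realize_relabel]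
    refine iff_of_eq (congrArg _ ?_)
    ext (i | i) <;> rfl
  exact ⟨_, key, key⟩

theorem DefSet.transfers {B : Set (α → M)} (h : DefSet L B) :
    Transfers (ElementaryEmbedding.refl L M) (· ∈ B) (· ∈ B) :=
  defSet_iff_transfers.1 h

theorem defSet_of_transfers {P : (α → M) → Prop}
    (h : Transfers (ElementaryEmbedding.refl L M) P P) : DefSet L {a | P a} :=
  h.defSet_left

end Transfer

/-! ### The product topology through open boxes. -/

section Boxes

variable {M : Type w}

/-- `U` is relatively open in `A`, expressed with open boxes. -/
def OpenIn [LT M] {n : ℕ} (A U : Set (Fin n → M)) : Prop :=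
  ∀ x, x ∈ U → ∃ l r : Fin n → M, (∀ i, l i < x i ∧ x i < r i) ∧
    ∀ y, y ∈ A → (∀ i, l i < y i ∧ y i < r i) → y ∈ U

/-- The relation with graph `G` is continuous, expressed with open boxes. -/
def ContGraph [LT M] {n m : ℕ} (G : Set (Fin n ⊕ Fin m → M)) : Prop :=
  ∀ x y, Sum.elim x y ∈ G → ∀ l r : Fin m → M, (∀ i, l i < y i ∧ y i < r i) →
    ∃ l' r' : Fin n → M, (∀ i, l' i < x i ∧ x i < r' i) ∧
      ∀ x' y', Sum.elim x' y' ∈ G → (∀ i, l' i < x' i ∧ x' i < r' i) →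
        ∀ i, l i < y' i ∧ y' i < r i

variable [LinearOrder M]

section

variable {L : FirstOrder.Language.{u, v}} [L.IsOrdered] [L.Structure M] [L.OrderedStructure M]
  {S : Type w'} [L.Structure S] [LinearOrder S] [L.OrderedStructure S] {f : M ↪ₑ[L] S} {α : Type*}

theorem Transfers.box {n : ℕ} (l x r : Fin n → α) :
    Transfers f (fun a => ∀ i, a (l i) < a (x i) ∧ a (x i) < a (r i))
      (fun a => ∀ i, a (l i) < a (x i) ∧ a (x i) < a (r i)) :=
  .forall_index fun i => (Transfers.lt (l i) (x i)).and (.lt (x i) (r i))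

/-- A box is given by its two corners, so relative openness quantifies over tuples only and is a
first-order sentence. -/
theorem Transfers.openIn_iff {n : ℕ} {A U : Set (Fin n → M)} {A' U' : Set (Fin n → S)}
    (hA : Transfers f (· ∈ A) (· ∈ A')) (hU : Transfers f (· ∈ U) (· ∈ U')) :
    OpenIn A U ↔ OpenIn A' U' := by
  refine Transfers.forall_iff (f := f) (.imp hU (.ex (.ex (.and ?_ (.all ?_)))))
  · exact .box _ _ _
  · exact .imp (.mem _ hA) (.imp (.box _ _ _) (.mem _ hU))

theorem Transfers.contGraph_iff {n m : ℕ} {G : Set (Fin n ⊕ Fin m → M)}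
    {G' : Set (Fin n ⊕ Fin m → S)} (hG : Transfers f (· ∈ G) (· ∈ G')) :
    ContGraph G ↔ ContGraph G' := by
  refine Transfers.forall_iff (f := f) (.all (.imp (.mem_elim _ _ hG) (.all (.all
    (.imp (.box _ _ _) (.ex (.ex (.and (.box _ _ _) (.all (.all (.imp ?_ ?_)))))))))))
  · exact .mem_elim _ _ hG
  · exact .imp (.box _ _ _) (.box _ _ _)

end

variable [NoMinOrder M] [NoMaxOrder M] [TopologicalSpace M] [OrderTopology M]

/-- Without endpoints in the order, bounded intervals suffice in every coordinate. -/
theorem hasBasis_nhds_box {n : ℕ} (x : Fin n → M) :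
    (𝓝 x).HasBasis (fun b : (Fin n → M) × (Fin n → M) => ∀ i, b.1 i < x i ∧ x i < b.2 i)
      (fun b => {y | ∀ i, b.1 i < y i ∧ y i < b.2 i}) := by
  refine ⟨fun t => ⟨fun ht => ?_, ?_⟩⟩
  · rw [nhds_pi, Filter.mem_pi] at ht
    obtain ⟨I, -, u, hu, hI⟩ := ht
    choose l r h h' using fun i => mem_nhds_iff_exists_Ioo_subset.1 (hu i)
    exact ⟨(l, r), h, fun y hy => hI fun i _ => h' i (hy i)⟩
  · rintro ⟨b, hb, hbt⟩
    refine Filter.mem_of_superset ?_ hbt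
    have := set_pi_mem_nhds (Set.finite_univ (α := Fin n))
      (s := fun i => Set.Ioo (b.1 i) (b.2 i)) (x := x) fun i _ => Ioo_mem_nhds (hb i).1 (hb i).2
    exact Filter.mem_of_superset this fun y hy i => hy i trivial

theorem openIn_iff {n : ℕ} {A U : Set (Fin n → M)} (hUA : U ⊆ A) :
    OpenIn A U ↔ ∃ V, IsOpen V ∧ U = V ∩ A := by
  constructor
  · intro h
    -- This is the largest open set whose trace on `A` is contained in `U`.
    refine ⟨interior {y | y ∈ A → y ∈ U}, isOpen_interior, Set.Subset.antisymm ?_ ?_⟩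
    · intro x hx
      obtain ⟨l, r, h₁, h₂⟩ := h x hx
      exact ⟨mem_interior_iff_mem_nhds.2 ((hasBasis_nhds_box x).mem_iff.2
        ⟨(l, r), h₁, fun y hy hyA => h₂ y hyA hy⟩), hUA hx⟩
    · intro x hx
      exact interior_subset hx.1 hx.2
  · rintro ⟨V, hV, rfl⟩ x hx
    obtain ⟨b, h₁, h₂⟩ := (hasBasis_nhds_box x).mem_iff.1 (hV.mem_nhds hx.1)
    exact ⟨b.1, b.2, h₁, fun y hy hb => ⟨h₂ hb, hy⟩⟩

theorem contGraph_iff_continuous {n m : ℕ} {G : Set (Fin n ⊕ Fin m → M)} {A : Set (Fin n → M)}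
    {B : Set (Fin m → M)} (h : A → B)
    (hG : ∀ x y, Sum.elim x y ∈ G ↔ ∃ hx : x ∈ A, (h ⟨x, hx⟩ : Fin m → M) = y) :
    ContGraph G ↔ Continuous h := by
  rw [continuous_induced_rng, continuous_iff_continuousAt]
  have key : ∀ p : A, ContinuousAt (Subtype.val ∘ h) p ↔ ∀ l r : Fin m → M,
      (∀ i, l i < (h p).1 i ∧ (h p).1 i < r i) →
      ∃ l' r' : Fin n → M, (∀ i, l' i < p.1 i ∧ p.1 i < r' i) ∧
      ∀ q : A, (∀ i, l' i < q.1 i ∧ q.1 i < r' i) → ∀ i, l i < (h q).1 i ∧ (h q).1 i < r i := by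
    intro p
    rw [ContinuousAt, nhds_subtype_eq_comap,
      ((hasBasis_nhds_box p.1).comap _).tendsto_iff (hasBasis_nhds_box _), Prod.forall]
    simp only [Prod.exists]
    rfl
  constructor
  · intro H p
    refine (key p).2 fun l r hlr => ?_
    obtain ⟨l', r', h₁, h₂⟩ := H p (h p) ((hG _ _).2 ⟨p.2, rfl⟩) l r hlr
    exact ⟨l', r', h₁, fun q hq => h₂ q (h q) ((hG _ _).2 ⟨q.2, rfl⟩) hq⟩
  · rintro H x y hxy l r hlr
    obtain ⟨hx, rfl⟩ := (hG _ _).1 hxy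
    obtain ⟨l', r', h₁, h₂⟩ := (key _).1 (H ⟨x, hx⟩) l r hlr
    refine ⟨l', r', h₁, fun x' y' hxy' hx' => ?_⟩
    obtain ⟨hx'', rfl⟩ := (hG _ _).1 hxy'
    exact h₂ ⟨x', hx''⟩ hx'

end Boxes

/-! ### Definable subsets and first-order criteria in charts. -/

namespace ChartedSet

section

variable {M : Type w} (X : ChartedSet.{w, x} M)

theorem imgOf_subset_img (A : Set X.carrier) (i : X.ι) : X.imgOf A i ⊆ X.img i := by
  rintro _ ⟨p, -, rfl⟩
  exact ⟨p, rfl⟩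

theorem imgOf_univ (i : X.ι) : X.imgOf Set.univ i = X.img i := by
  ext p
  simp [imgOf, img]

theorem mem_imgOf {A : Set X.carrier} {i : X.ι} {p : Fin (X.dim i) → M} :
    p ∈ X.imgOf A i ↔ ∃ (a : X.carrier) (h : a ∈ X.dom i), a ∈ A ∧ X.chart i ⟨a, h⟩ = p := by
  constructor
  · rintro ⟨⟨a, h⟩, ha, rfl⟩
    exact ⟨a, h, ha, rfl⟩
  · rintro ⟨a, h, ha, rfl⟩
    exact ⟨⟨a, h⟩, ha, rfl⟩

variable {X}

theorem imgOf_mono {A B : Set X.carrier} (h : A ⊆ B) (i : X.ι) : X.imgOf A i ⊆ X.imgOf B i :=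
  Set.image_mono fun _ hp => h hp

theorem chart_mem_imgOf (hinj : ∀ i, Function.Injective (X.chart i)) {A : Set X.carrier} {i : X.ι}
    {a : X.carrier} (h : a ∈ X.dom i) : X.chart i ⟨a, h⟩ ∈ X.imgOf A i ↔ a ∈ A := by
  refine ⟨?_, fun ha => ⟨_, ha, rfl⟩⟩
  rintro ⟨p, hp, hpa⟩
  rw [hinj i hpa] at hp
  exact hp

theorem chart_mem_transGraph (hinj : ∀ i, Function.Injective (X.chart i)) {i j : X.ι}
    {a : X.carrier} (h : a ∈ X.dom i) {y : Fin (X.dim j) → M} :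
    Sum.elim (X.chart i ⟨a, h⟩) y ∈ X.transGraph i j ↔
      ∃ h' : a ∈ X.dom j, X.chart j ⟨a, h'⟩ = y := by
  constructor
  · rintro ⟨b, hi, hj, hb⟩
    obtain ⟨h₁, rfl⟩ := Sum.elim_eq_iff.1 hb
    obtain rfl : a = b := congrArg Subtype.val (hinj i h₁)
    exact ⟨hj, rfl⟩
  · rintro ⟨h', rfl⟩
    exact ⟨a, h, h', rfl⟩

end

end ChartedSet

theorem exists_box_inter {M : Type w} [LinearOrder M] {n : ℕ} {x l r l' r' : Fin n → M}
    (h : ∀ i, l i < x i ∧ x i < r i) (h' : ∀ i, l' i < x i ∧ x i < r' i) :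
    ∃ l₁ r₁ : Fin n → M, (∀ i, l₁ i < x i ∧ x i < r₁ i) ∧
      ∀ y : Fin n → M, (∀ i, l₁ i < y i ∧ y i < r₁ i) →
        (∀ i, l i < y i ∧ y i < r i) ∧ ∀ i, l' i < y i ∧ y i < r' i :=
  ⟨fun i => max (l i) (l' i), fun i => min (r i) (r' i),
    fun i => ⟨max_lt (h i).1 (h' i).1, lt_min (h i).2 (h' i).2⟩, fun _ hy =>
    ⟨fun i => ⟨(max_lt_iff.1 (hy i).1).1, (lt_min_iff.1 (hy i).2).1⟩,
      fun i => ⟨(max_lt_iff.1 (hy i).1).2, (lt_min_iff.1 (hy i).2).2⟩⟩⟩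

namespace ChartedSet

variable {L : FirstOrder.Language.{u, v}} {M : Type w} [L.Structure M]
  {X : ChartedSet.{w, x} M}

theorem elim_mem_transGraph {i j : X.ι} {p : Fin (X.dim i) → M} {q : Fin (X.dim j) → M} :
    Sum.elim p q ∈ X.transGraph i j ↔ ∃ (a : X.carrier) (hi : a ∈ X.dom i) (hj : a ∈ X.dom j),
      X.chart i ⟨a, hi⟩ = p ∧ X.chart j ⟨a, hj⟩ = q := by
  constructor
  · rintro ⟨a, hi, hj, h⟩
    obtain ⟨h₁, h₂⟩ := Sum.elim_eq_iff.1 h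
    exact ⟨a, hi, hj, h₁.symm, h₂.symm⟩
  · rintro ⟨a, hi, hj, rfl, rfl⟩
    exact ⟨a, hi, hj, rfl⟩

theorem imgOf_dom_eq (i j : X.ι) :
    X.imgOf (X.dom j) i = {p | ∃ q, Sum.elim p q ∈ X.transGraph i j} := by
  ext p
  simp only [mem_imgOf, Set.mem_ofPred_eq, elim_mem_transGraph]
  constructor
  · rintro ⟨a, hi, hj, rfl⟩
    exact ⟨_, a, hi, hj, rfl, rfl⟩
  · rintro ⟨_, a, hi, hj, rfl, rfl⟩
    exact ⟨a, hi, hj, rfl⟩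

theorem imgOf_compl (hinj : ∀ i, Function.Injective (X.chart i)) (A : Set X.carrier) (i : X.ι) :
    X.imgOf Aᶜ i = X.img i \ X.imgOf A i := by
  ext p
  constructor
  · rintro ⟨⟨a, h⟩, ha, rfl⟩
    exact ⟨⟨_, rfl⟩, fun h' => ha ((chart_mem_imgOf hinj h).1 h')⟩
  · rintro ⟨⟨⟨a, h⟩, rfl⟩, ha⟩
    exact ⟨_, fun h' => ha ((chart_mem_imgOf hinj h).2 h'), rfl⟩

theorem imgOf_inter (hinj : ∀ i, Function.Injective (X.chart i)) (A B : Set X.carrier) (i : X.ι) :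
    X.imgOf (A ∩ B) i = X.imgOf A i ∩ X.imgOf B i := by
  ext p
  constructor
  · rintro ⟨⟨a, h⟩, ha, rfl⟩
    exact ⟨⟨_, ha.1, rfl⟩, ⟨_, ha.2, rfl⟩⟩
  · rintro ⟨⟨⟨a, h⟩, ha, rfl⟩, hb⟩
    exact ⟨_, ⟨ha, (chart_mem_imgOf hinj h).1 hb⟩, rfl⟩

theorem imgOf_union (A B : Set X.carrier) (i : X.ι) :
    X.imgOf (A ∪ B) i = X.imgOf A i ∪ X.imgOf B i :=
  Set.image_union (X.chart i) {p | (p : X.carrier) ∈ A} {p | (p : X.carrier) ∈ B}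

theorem imgOf_eq_of_subset_dom (hinj : ∀ i, Function.Injective (X.chart i)) {A : Set X.carrier}
    {i : X.ι} (hA : A ⊆ X.dom i) (j : X.ι) :
    X.imgOf A j = {q | ∃ p, p ∈ X.imgOf A i ∧ Sum.elim p q ∈ X.transGraph i j} := by
  ext q
  constructor
  · rintro ⟨⟨a, h⟩, ha, rfl⟩
    exact ⟨_, ⟨⟨a, hA ha⟩, ha, rfl⟩, a, hA ha, h, rfl⟩
  · rintro ⟨_, ⟨⟨a, h⟩, ha, rfl⟩, hq⟩
    obtain ⟨h', rfl⟩ := (chart_mem_transGraph hinj h).1 hq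
    exact ⟨_, ha, rfl⟩

namespace IsDefSubset

section

variable {A B : Set X.carrier} [TopologicalSpace M] (hX : X.IsDefinableSpace L)
include hX

theorem compl (hA : X.IsDefSubset L A) : X.IsDefSubset L Aᶜ := fun i => by
  rw [imgOf_compl hX.inj]
  exact (hX.img_def i).sdiff (hA i)

theorem inter (hA : X.IsDefSubset L A) (hB : X.IsDefSubset L B) : X.IsDefSubset L (A ∩ B) :=
  fun i => by
    rw [imgOf_inter hX.inj]
    exact (hA i).inter (hB i)

/-- The images in the other charts are obtained from the `i`-th one through the definable transition
graphs, so one chart suffices. -/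
theorem of_subset_dom {i : X.ι} (hA : A ⊆ X.dom i) (h : DefSet L (X.imgOf A i)) :
    X.IsDefSubset L A := fun j => by
  rw [imgOf_eq_of_subset_dom hX.inj hA]
  exact defSet_of_transfers (.ex (.and (.mem _ h.transfers)
    (.mem_elim _ _ (hX.trans_def i j).transfers)))

theorem dom (i : X.ι) : X.IsDefSubset L (X.dom i) := fun j => hX.overlap_def j i

theorem univ : X.IsDefSubset L Set.univ := fun j => by
  rw [imgOf_univ]
  exact hX.img_def j

end

variable {A B : Set X.carrier}

theorem union (hA : X.IsDefSubset L A) (hB : X.IsDefSubset L B) : X.IsDefSubset L (A ∪ B) :=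
  fun i => by
    rw [imgOf_union]
    exact (hA i).union (hB i)

theorem empty : X.IsDefSubset L ∅ := fun i => by
  simp [imgOf, Set.definable_empty]

end IsDefSubset

/-- The open definable subsets of `X`. -/
def DefOpen (L : FirstOrder.Language.{u, v}) [L.Structure M]
    [TopologicalSpace M] (X : ChartedSet.{w, x} M)
    (U : Set X.carrier) : Prop :=
  X.IsDefSubset L U ∧ IsOpen[X.top] U

namespace DefOpen

variable {U V : Set X.carrier} [TopologicalSpace M]

theorem union (hU : X.DefOpen L U) (hV : X.DefOpen L V) : X.DefOpen L (U ∪ V) :=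
  ⟨hU.1.union hV.1, @IsOpen.union _ _ _ X.top hU.2 hV.2⟩

theorem inter (hX : X.IsDefinableSpace L) (hU : X.DefOpen L U) (hV : X.DefOpen L V) :
    X.DefOpen L (U ∩ V) :=
  ⟨hU.1.inter hX hV.1, letI := X.top; hU.2.inter hV.2⟩

theorem empty : X.DefOpen L ∅ := ⟨.empty, @isOpen_empty _ X.top⟩

theorem univ (hX : X.IsDefinableSpace L) : X.DefOpen L Set.univ :=
  ⟨.univ hX, @isOpen_univ _ X.top⟩

end DefOpen

section

variable [LinearOrder M] [NoMinOrder M] [NoMaxOrder M] [TopologicalSpace M] [OrderTopology M]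

/-- The topological axioms appear only as conditions on graphs, which pass to subspaces, products
and elementary extensions. The transition from `j` to `i` is the inverse of the one from `i` to `j`,
so continuity for all pairs gives homeomorphisms. -/
theorem isDefinableSpace_of_graphs (cover : ∀ a : X.carrier, ∃ i, a ∈ X.dom i)
    (inj : ∀ i, Function.Injective (X.chart i)) (img_def : ∀ i, DefSet L (X.img i))
    (trans_def : ∀ i j, DefSet L (X.transGraph i j))
    (overlap : ∀ i j, OpenIn (X.img i) (X.imgOf (X.dom j) i))
    (cont : ∀ i j, ContGraph (X.transGraph i j)) : X.IsDefinableSpace L where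
  cover := cover
  inj := inj
  img_def := img_def
  overlap_def i j := by
    rw [imgOf_dom_eq]
    exact defSet_of_transfers (.ex (.mem_elim _ _ (trans_def i j).transfers))
  overlap_open i j := (openIn_iff (imgOf_subset_img _ _ _)).1 (overlap i j)
  trans_def := trans_def
  trans_homeo i j := by
    have fwd : ∀ i j (p : X.imgOf (X.dom j) i), ∃ q : X.imgOf (X.dom i) j,
        Sum.elim (p : Fin (X.dim i) → M) (q : Fin (X.dim j) → M) ∈ X.transGraph i j := by
      rintro i j ⟨_, ⟨a, hi⟩, hj, rfl⟩
      exact ⟨⟨_, ⟨a, hj⟩, hi, rfl⟩, a, hi, hj, rfl⟩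
    choose F hF using fwd
    have hFF : ∀ i j p, F j i (F i j p) = p := by
      rintro i j ⟨_, ⟨a, hi⟩, hj, rfl⟩
      obtain ⟨h', h₁⟩ := (chart_mem_transGraph inj hi).1 (hF i j ⟨_, ⟨a, hi⟩, hj, rfl⟩)
      have h₂ := hF j i (F i j ⟨_, ⟨a, hi⟩, hj, rfl⟩)
      rw [← h₁] at h₂
      obtain ⟨_, h₃⟩ := (chart_mem_transGraph inj h').1 h₂
      exact Subtype.ext h₃.symm
    have hc : ∀ i j, Continuous (F i j) := by
      intro i j
      refine (contGraph_iff_continuous (G := X.transGraph i j) (F i j) fun p q => ?_).1 (cont i j)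
      constructor
      · intro h
        obtain ⟨a, hi, hj, rfl, rfl⟩ := elim_mem_transGraph.1 h
        refine ⟨⟨_, hj, rfl⟩, ?_⟩
        obtain ⟨_, h₁⟩ := (chart_mem_transGraph inj hi).1 (hF i j ⟨_, ⟨a, hi⟩, hj, rfl⟩)
        exact h₁.symm
      · rintro ⟨hp, rfl⟩
        exact hF i j ⟨p, hp⟩
    exact ⟨⟨⟨F i j, F j i, hFF i j, hFF j i⟩, hc i j, hc j i⟩, hF i j⟩

theorem IsDefinableSpace.openIn_overlap (h : X.IsDefinableSpace L) (i j : X.ι) :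
    OpenIn (X.img i) (X.imgOf (X.dom j) i) :=
  (openIn_iff (imgOf_subset_img _ _ _)).2 (h.overlap_open i j)

theorem IsDefinableSpace.contGraph (h : X.IsDefinableSpace L) (i j : X.ι) :
    ContGraph (X.transGraph i j) := by
  obtain ⟨e, he⟩ := h.trans_homeo i j
  refine (contGraph_iff_continuous (A := X.imgOf (X.dom j) i) (B := X.imgOf (X.dom i) j)
    e fun p q => ?_).2 e.continuous
  constructor
  · intro hpq
    obtain ⟨a, hi, hj, rfl, rfl⟩ := elim_mem_transGraph.1 hpq
    refine ⟨⟨_, hj, rfl⟩, ?_⟩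
    obtain ⟨_, h₁⟩ := (chart_mem_transGraph h.inj hi).1 (he ⟨_, ⟨a, hi⟩, hj, rfl⟩)
    exact h₁.symm
  · rintro ⟨hp, rfl⟩
    exact he ⟨p, hp⟩

theorem isOpen_iff_openIn (hinj : ∀ i, Function.Injective (X.chart i)) (U : Set X.carrier) :
    IsOpen[X.top] U ↔ ∀ i, OpenIn (X.img i) (X.imgOf U i) :=
  (isOpen_top_iff X hinj U).trans
    (forall_congr' fun i => (openIn_iff (imgOf_subset_img X U i)).symm)

/-- In any other chart the image is the preimage of an open set under a continuous transition map
with open domain. -/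
theorem IsDefinableSpace.isOpen_of_subset_dom (hX : X.IsDefinableSpace L) {U : Set X.carrier}
    {i : X.ι} (hU : U ⊆ X.dom i) (h : OpenIn (X.img i) (X.imgOf U i)) : IsOpen[X.top] U := by
  refine (isOpen_iff_openIn hX.inj U).2 fun j => ?_
  rintro _ ⟨⟨a, hj⟩, ha, rfl⟩
  have hi := hU ha
  obtain ⟨l, r, h₁, h₂⟩ := h _ ⟨⟨a, hi⟩, ha, rfl⟩
  -- This box is carried into the given box of chart `i`, where the transition is defined; the next
  -- one keeps nearby points in the domain of the transition.
  obtain ⟨l', r', h₁', h₂'⟩ := hX.contGraph j i _ _ ⟨a, hj, hi, rfl⟩ l r h₁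
  obtain ⟨l'', r'', h₁'', h₂''⟩ := hX.openIn_overlap j i _ ⟨⟨a, hj⟩, hi, rfl⟩
  obtain ⟨l₀, r₀, k₁, k₂⟩ := exists_box_inter h₁' h₁''
  refine ⟨l₀, r₀, k₁, fun y hy hyb => ?_⟩
  obtain ⟨⟨b, hbj⟩, hbi, rfl⟩ := h₂'' y hy (k₂ y hyb).2
  have := h₂ (X.chart i ⟨b, hbi⟩) ⟨_, rfl⟩ (h₂' _ _ ⟨b, hbj, hbi, rfl⟩ (k₂ _ hyb).1)
  exact ⟨_, (chart_mem_imgOf hX.inj hbi).1 this, rfl⟩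

theorem IsDefinableSpace.defOpen_dom (hX : X.IsDefinableSpace L) (i : X.ι) :
    X.DefOpen L (X.dom i) :=
  ⟨.dom hX i, (isOpen_iff_openIn hX.inj _).2 fun j => hX.openIn_overlap j i⟩


end

end ChartedSet

/-! ### Shrinking of covers and gluing of normality, for a family of sets. -/

section Separation

variable {α : Type*} {P : Set α → Prop}

/-- Disjoint sets whose complements belong to the family `P` are separated by disjoint members
of `P`. -/
def SepNormal (P : Set α → Prop) : Prop :=
  ∀ Z₁ Z₂ : Set α, P Z₁ᶜ → P Z₂ᶜ → Disjoint Z₁ Z₂ →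
    ∃ U₁ U₂, P U₁ ∧ P U₂ ∧ Disjoint U₁ U₂ ∧ Z₁ ⊆ U₁ ∧ Z₂ ⊆ U₂

/-- The shrinking lemma for a finite cover by members of `P`. -/
theorem SepNormal.exists_shrinking (hP : SepNormal P) (hempty : P ∅)
    (hunion : ∀ U V, P U → P V → P (U ∪ V)) {ι : Type*} [Finite ι] {W : ι → Set α}
    (hW : ∀ i, P (W i)) (hcover : ⋃ i, W i = Set.univ) :
    ∃ C : ι → Set α, (∀ i, P (C i)ᶜ) ∧ (∀ i, C i ⊆ W i) ∧ ⋃ i, C i = Set.univ := by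
  classical
  cases nonempty_fintype ι
  have hbi : ∀ (V : ι → Set α) (s : Finset ι), (∀ i, P (V i)) → P (⋃ i ∈ s, V i) := by
    intro V s hV
    induction s using Finset.induction_on with
    | empty => simpa using hempty
    | insert i s _ ih =>
      rw [Finset.set_biUnion_insert]
      exact hunion _ _ (hV i) ih
  -- Induction invariant: for the indices treated so far `V i ⊆ C i ⊆ W i` with `V i` open and `C i`
  -- closed, and these `V i` together with the untreated `W i` still cover.
  have step : ∀ s : Finset ι, ∃ V C : ι → Set α, (∀ i, P (V i)) ∧ (∀ i ∈ s, P (C i)ᶜ) ∧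
      (∀ i ∈ s, V i ⊆ C i) ∧ (∀ i ∈ s, C i ⊆ W i) ∧
      (⋃ i ∈ s, V i) ∪ (⋃ i ∈ sᶜ, W i) = Set.univ := by
    intro s
    induction s using Finset.induction_on with
    | empty => exact ⟨W, W, hW, by simp, by simp, by simp, by simpa using hcover⟩
    | insert j s hj ih =>
      obtain ⟨V, C, hV, hC, hVC, hCW, hVW⟩ := ih
      -- The points covered by no other member form a closed set inside `W j`. Separating it from
      -- the complement of `W j` yields `V j = U₁` and `C j = U₂ᶜ`.
      obtain ⟨U₁, U₂, hU₁, hU₂, hdis, h₁, h₂⟩ := hP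
        ((⋃ i ∈ s, V i) ∪ (⋃ i ∈ (insert j s)ᶜ, W i))ᶜ (W j)ᶜ
        (by rw [compl_compl]; exact hunion _ _ (hbi _ _ hV) (hbi _ _ hW))
        (by rw [compl_compl]; exact hW j) (by
          rw [Set.disjoint_compl_right_iff_subset]
          intro a ha
          have ha' : a ∈ (⋃ i ∈ s, V i) ∪ (⋃ i ∈ sᶜ, W i) := hVW ▸ trivial
          simp only [Set.mem_compl_iff, Set.mem_union, Set.mem_iUnion, Finset.mem_compl,
            Finset.mem_insert, exists_prop, not_or, not_exists, not_and] at ha ha'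
          rcases ha' with ⟨i, hi, h⟩ | ⟨i, hi, h⟩
          · exact absurd h (ha.1 i hi)
          · by_contra hj'
            exact ha.2 i ⟨fun e => hj' (e ▸ h), hi⟩ h)
      have hne : ∀ i ∈ s, i ≠ j := fun i hi e => hj (e ▸ hi)
      refine ⟨Function.update V j U₁, Function.update C j U₂ᶜ, fun i => ?_, fun i hi => ?_,
        fun i hi => ?_, fun i hi => ?_, ?_⟩
      · rcases eq_or_ne i j with rfl | h
        · simpa using hU₁
        · simpa [h] using hV i
      · rcases eq_or_ne i j with rfl | h
        · simpa using hU₂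
        · simpa [h] using hC i (Finset.mem_of_mem_insert_of_ne hi h)
      · rcases eq_or_ne i j with rfl | h
        · simpa using hdis.subset_compl_right
        · simpa [h] using hVC i (Finset.mem_of_mem_insert_of_ne hi h)
      · rcases eq_or_ne i j with rfl | h
        · simpa using Set.compl_subset_comm.1 h₂
        · simpa [h] using hCW i (Finset.mem_of_mem_insert_of_ne hi h)
      · refine Set.eq_univ_of_forall fun a => ?_
        by_cases ha : a ∈ (⋃ i ∈ s, V i) ∪ (⋃ i ∈ (insert j s)ᶜ, W i)
        · rcases ha with ha | ha
          · left
            simp only [Set.mem_iUnion] at ha ⊢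
            obtain ⟨i, hi, h⟩ := ha
            exact ⟨i, Finset.mem_insert_of_mem hi, by simpa [hne i hi] using h⟩
          · exact Or.inr ha
        · left
          simp only [Set.mem_iUnion]
          exact ⟨j, Finset.mem_insert_self _ _, by simpa using h₁ ha⟩
  obtain ⟨V, C, -, hC, hVC, hCW, hVW⟩ := step Finset.univ
  refine ⟨C, fun i => hC i (Finset.mem_univ _), fun i => hCW i (Finset.mem_univ _), ?_⟩
  refine Set.eq_univ_of_forall fun a => ?_
  have ha : a ∈ (⋃ i ∈ Finset.univ, V i) ∪ (⋃ i ∈ Finset.univᶜ, W i) := hVW ▸ trivial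
  simp only [Finset.mem_univ, Set.iUnion_true, Finset.compl_univ, Finset.notMem_empty,
    Set.iUnion_of_empty, Set.iUnion_empty, Set.union_empty, Set.mem_iUnion] at ha ⊢
  obtain ⟨i, hi⟩ := ha
  exact ⟨i, hVC i (Finset.mem_univ _) hi⟩

/-- Normality is inherited along finitely many jointly surjective closed maps. -/
theorem SepNormal.of_closed_cover (huniv : P Set.univ) (hinter : ∀ U V, P U → P V → P (U ∩ V))
    {κ : Type*} [Finite κ] {β : κ → Type*} {Q : ∀ k, Set (β k) → Prop} (g : ∀ k, β k → α)
    (hg : ∀ a, ∃ k b, g k b = a) (hpre : ∀ k U, P U → Q k (g k ⁻¹' U))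
    (himage : ∀ k U, Q k U → P (g k '' Uᶜ)ᶜ) (hQ : ∀ k, SepNormal (Q k)) : SepNormal P := by
  intro Z₁ Z₂ h₁ h₂ hdis
  choose U₁ U₂ hU₁ hU₂ hU hZ₁ hZ₂ using fun k => hQ k (g k ⁻¹' Z₁) (g k ⁻¹' Z₂)
    (hpre k _ h₁) (hpre k _ h₂) (hdis.preimage _)
  have hbi : ∀ V : κ → Set α, (∀ k, P (V k)) → P (⋂ k, V k) := by
    classical
    cases nonempty_fintype κ
    intro V hV
    have : ∀ s : Finset κ, P (⋂ k ∈ s, V k) := by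
      intro s
      induction s using Finset.induction_on with
      | empty => simpa using huniv
      | insert i s _ ih =>
        rw [Finset.set_biInter_insert]
        exact hinter _ _ (hV i) ih
    simpa using this Finset.univ
  -- A point belongs to the first set when all its preimages under every `g k` lie in `U₁ k`.
  -- Disjointness holds because every point has at least one preimage.
  refine ⟨⋂ k, (g k '' (U₁ k)ᶜ)ᶜ, ⋂ k, (g k '' (U₂ k)ᶜ)ᶜ, hbi _ fun k => himage k _ (hU₁ k),
    hbi _ fun k => himage k _ (hU₂ k), ?_, ?_, ?_⟩
  · rw [Set.disjoint_left]
    intro a ha ha'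
    obtain ⟨k, b, rfl⟩ := hg a
    have hb : b ∈ U₁ k := by
      by_contra h
      exact Set.mem_iInter.1 ha k ⟨b, h, rfl⟩
    have hb' : b ∈ U₂ k := by
      by_contra h
      exact Set.mem_iInter.1 ha' k ⟨b, h, rfl⟩
    exact Set.disjoint_left.1 (hU k) hb hb'
  · rintro a ha
    refine Set.mem_iInter.2 fun k => ?_
    rintro ⟨b, hb, rfl⟩
    exact hb (hZ₁ k ha)
  · rintro a ha
    refine Set.mem_iInter.2 fun k => ?_
    rintro ⟨b, hb, rfl⟩
    exact hb (hZ₂ k ha)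

end Separation

/-! ### Subspaces, closed covers and closed affine pieces. -/

theorem ContGraph.mono {M : Type w} [LT M] {n m : ℕ} {G G' : Set (Fin n ⊕ Fin m → M)}
    (h : ContGraph G) (hG : G' ⊆ G) : ContGraph G' := by
  intro x y hxy l r hlr
  obtain ⟨l', r', h₁, h₂⟩ := h x y (hG hxy) l r hlr
  exact ⟨l', r', h₁, fun x' y' h' => h₂ x' y' (hG h')⟩

namespace ChartedSet

variable {L : FirstOrder.Language.{u, v}} {M : Type w} [L.Structure M]
  {X : ChartedSet.{w, x} M}

/-- The charts of `X` pulled back along a map into its carrier. -/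
@[reducible] def pullback (X : ChartedSet.{w, x} M) {c : Type y} (g : c → X.carrier) :
    ChartedSet.{w, y} M where
  carrier := c
  ι := X.ι
  fin := X.fin
  dim := X.dim
  dom i := g ⁻¹' X.dom i
  chart i p := X.chart i ⟨g p.1, p.2⟩

theorem isDefinablyNormal_iff [TopologicalSpace M] :
    X.IsDefinablyNormal L ↔ X.IsDefinableSpace L ∧ SepNormal (X.DefOpen L) := by
  refine and_congr_right fun hX => ?_
  have hc : ∀ Z : Set X.carrier, X.IsDefSubset L Z ∧ IsClosed[X.top] Z ↔ X.DefOpen L Zᶜ :=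
    fun Z => and_congr ⟨fun h => h.compl hX, fun h => by simpa using h.compl hX⟩
      (@isOpen_compl_iff _ _ X.top).symm
  constructor
  · intro h Z₁ Z₂ h₁ h₂ hd
    obtain ⟨U₁, U₂, a, b, c, d, e⟩ := h Z₁ Z₂ ((hc _).2 h₁).1 ((hc _).2 h₂).1 ((hc _).2 h₁).2
      ((hc _).2 h₂).2 hd
    exact ⟨U₁, U₂, ⟨a, c⟩, ⟨b, d⟩, e⟩
  · intro h Z₁ Z₂ h₁ h₂ h₁' h₂' hd
    obtain ⟨U₁, U₂, a, b, c⟩ := h Z₁ Z₂ ((hc _).1 ⟨h₁, h₁'⟩) ((hc _).1 ⟨h₂, h₂'⟩) hd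
    exact ⟨U₁, U₂, a.1, b.1, a.2, b.2, c⟩

section Pullback

variable {c : Type y} {g : c → X.carrier}

theorem imgOf_pullback (B : Set c) (i : X.ι) : (X.pullback g).imgOf B i = X.imgOf (g '' B) i := by
  ext p
  simp only [mem_imgOf]
  constructor
  · rintro ⟨a, h, ha, rfl⟩
    exact ⟨g a, h, ⟨a, ha, rfl⟩, rfl⟩
  · rintro ⟨_, h, ⟨a, ha, rfl⟩, rfl⟩
    exact ⟨a, h, ha, rfl⟩

theorem img_pullback (i : X.ι) : (X.pullback g).img i = X.imgOf (Set.range g) i := by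
  rw [← imgOf_univ, imgOf_pullback, Set.image_univ]

theorem transGraph_pullback (hinj : ∀ i, Function.Injective (X.chart i)) (i j : X.ι) :
    (X.pullback g).transGraph i j = {p | p ∈ X.transGraph i j ∧
      (fun k => p (Sum.inl k)) ∈ X.imgOf (Set.range g) i} := by
  ext p
  constructor
  · rintro ⟨a, hi, hj, rfl⟩
    exact ⟨⟨g a, hi, hj, rfl⟩, ⟨_, hi⟩, ⟨a, rfl⟩, rfl⟩
  · rintro ⟨⟨_, hi, hj, rfl⟩, h⟩
    obtain ⟨a, rfl⟩ := (chart_mem_imgOf hinj hi).1 h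
    exact ⟨a, hi, hj, rfl⟩

end Pullback

section

variable [LinearOrder M] [NoMinOrder M] [NoMaxOrder M] [TopologicalSpace M] [OrderTopology M]
  {c : Type y} {g : c → X.carrier}

theorem IsDefinableSpace.pullback (hX : X.IsDefinableSpace L) (hg : Function.Injective g)
    (hR : X.IsDefSubset L (Set.range g)) : (X.pullback g).IsDefinableSpace L := by
  refine isDefinableSpace_of_graphs (fun a => hX.cover (g a)) ?_ ?_ ?_ ?_ ?_
  · rintro i ⟨p, hp⟩ ⟨q, hq⟩ hpq
    exact Subtype.ext (hg (congrArg Subtype.val (hX.inj i hpq)))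
  · intro i
    rw [img_pullback]
    exact hR i
  · intro i j
    rw [transGraph_pullback hX.inj]
    exact defSet_of_transfers (.and (hX.trans_def i j).transfers (.mem _ (hR i).transfers))
  · intro i j
    rw [img_pullback, imgOf_pullback]
    rintro _ ⟨⟨_, hi⟩, ⟨a, ha, rfl⟩, rfl⟩
    obtain ⟨l, r, h₁, h₂⟩ := hX.openIn_overlap i j _ ⟨⟨_, hi⟩, ha, rfl⟩
    refine ⟨l, r, h₁, ?_⟩
    rintro _ ⟨⟨_, hb⟩, ⟨b, rfl⟩, rfl⟩ hbb
    have := (chart_mem_imgOf hX.inj hb).1 (h₂ _ ⟨_, rfl⟩ hbb)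
    exact ⟨⟨_, hb⟩, ⟨b, this, rfl⟩, rfl⟩
  · intro i j
    refine (hX.contGraph i j).mono ?_
    rw [transGraph_pullback hX.inj]
    exact fun p hp => hp.1

theorem DefOpen.preimage (hX : X.IsDefinableSpace L) (hg : Function.Injective g)
    (hR : X.IsDefSubset L (Set.range g)) {U : Set X.carrier} (hU : X.DefOpen L U) :
    (X.pullback g).DefOpen L (g ⁻¹' U) := by
  refine ⟨fun i => ?_, (isOpen_iff_openIn (hX.pullback hg hR).inj _).2 fun i => ?_⟩
  · rw [imgOf_pullback, Set.image_preimage_eq_inter_range]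
    exact hU.1.inter hX hR i
  · rw [imgOf_pullback, img_pullback]
    rintro _ ⟨⟨_, hi⟩, ⟨a, ha, rfl⟩, rfl⟩
    obtain ⟨l, r, h₁, h₂⟩ := (isOpen_iff_openIn hX.inj U).1 hU.2 i _ ⟨⟨_, hi⟩, ha, rfl⟩
    refine ⟨l, r, h₁, ?_⟩
    rintro _ ⟨⟨_, hb⟩, ⟨b, rfl⟩, rfl⟩ hbb
    have := (chart_mem_imgOf hX.inj hb).1 (h₂ _ ⟨_, rfl⟩ hbb)
    exact ⟨⟨_, hb⟩, ⟨b, this, rfl⟩, rfl⟩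

/-- A closed subset of a closed subspace is closed. At a point of `g '' U` the box from the subspace
works, since points of the box off the range are harmless; elsewhere the complement of the range is
open. -/
theorem DefOpen.compl_image_compl (hX : X.IsDefinableSpace L) (hg : Function.Injective g)
    (hR : X.DefOpen L (Set.range g)ᶜ) {U : Set c} (hU : (X.pullback g).DefOpen L U) :
    X.DefOpen L (g '' Uᶜ)ᶜ := by
  have hR' : X.IsDefSubset L (Set.range g) := by simpa using hR.1.compl hX
  have hUo := (isOpen_iff_openIn (hX.pullback hg hR').inj U).1 hU.2
  have heq : (g '' Uᶜ)ᶜ = g '' U ∪ (Set.range g)ᶜ := by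
    rw [Set.image_compl_eq_range_sdiff_image hg]
    ext a
    simp only [Set.mem_compl_iff, Set.mem_sdiff, not_and_or, not_not, Set.mem_union]
    tauto
  have hdef : X.IsDefSubset L (g '' U) := fun i => by
    rw [← imgOf_pullback]
    exact hU.1 i
  rw [heq]
  refine ⟨hdef.union hR.1, (isOpen_iff_openIn hX.inj _).2 fun i => ?_⟩
  rintro _ ⟨⟨a, hi⟩, ha | ha, rfl⟩
  · have := hUo i
    rw [imgOf_pullback, img_pullback] at this
    obtain ⟨l, r, h₁, h₂⟩ := this _ ⟨⟨a, hi⟩, ha, rfl⟩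
    refine ⟨l, r, h₁, ?_⟩
    rintro _ ⟨⟨b, hb⟩, rfl⟩ hbb
    by_cases hbR : b ∈ Set.range g
    · exact imgOf_mono Set.subset_union_left _ (h₂ _ ⟨_, hbR, rfl⟩ hbb)
    · exact ⟨⟨b, hb⟩, Or.inr hbR, rfl⟩
  · obtain ⟨l, r, h₁, h₂⟩ := (isOpen_iff_openIn hX.inj _).1 hR.2 i _ ⟨⟨a, hi⟩, ha, rfl⟩
    exact ⟨l, r, h₁, fun y hy hyb => imgOf_mono Set.subset_union_right _ (h₂ y hy hyb)⟩

/-- A definable space with a finite cover by closed definably normal subspaces is definably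
normal. -/
theorem IsDefinableSpace.isDefinablyNormal_of_closed_cover (hX : X.IsDefinableSpace L)
    {κ : Type*} [Finite κ] {c : κ → Type y} (g : ∀ k, c k → X.carrier)
    (hg : ∀ k, Function.Injective (g k)) (hR : ∀ k, X.DefOpen L (Set.range (g k))ᶜ)
    (hcover : ∀ a, ∃ k b, g k b = a) (h : ∀ k, SepNormal ((X.pullback (g k)).DefOpen L)) :
    X.IsDefinablyNormal L :=
  isDefinablyNormal_iff.2 ⟨hX, .of_closed_cover (.univ hX) (fun _ _ hU hV => hU.inter hX hV) g
    hcover (fun k _ hU => hU.preimage hX (hg k) (by simpa using (hR k).1.compl hX))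
    (fun k _ hU => DefOpen.compl_image_compl hX (hg k) (hR k) hU) h⟩

theorem IsDefinablyNormal.exists_shrinking (h : X.IsDefinablyNormal L) :
    ∃ C : X.ι → Set X.carrier, (∀ i, X.DefOpen L (C i)ᶜ) ∧ (∀ i, C i ⊆ X.dom i) ∧
      ⋃ i, C i = Set.univ := by
  obtain ⟨hX, hN⟩ := isDefinablyNormal_iff.1 h
  have := X.fin
  exact hN.exists_shrinking .empty (fun _ _ hU hV => hU.union hV) hX.defOpen_dom
    (Set.eq_univ_of_forall fun a => Set.mem_iUnion.2 (hX.cover a))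

/-- The `i`-th chart is defined on all of `C` and is the required homeomorphism: the topology of `C`
can be read in that chart alone, and in chart `k` the graph of the map is a transition graph
restricted to `C`. -/
theorem IsDefinableSpace.isClosedAffine (hX : X.IsDefinableSpace L) {C : Set X.carrier}
    {i : X.ι} (hC : X.DefOpen L Cᶜ) (hCi : C ⊆ X.dom i) : X.IsClosedAffine L C := by
  have hC' : X.IsDefSubset L C := by simpa using hC.1.compl hX
  refine ⟨hC', @IsClosed.mk _ X.top _ hC.2, X.dim i, X.imgOf C i, ?_⟩
  -- `restrict` is definitionally the pullback along the inclusion.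
  have hP : (X.restrict C).IsDefinableSpace L :=
    hX.pullback (g := (Subtype.val : C → X.carrier)) Subtype.val_injective (by simpa using hC')
  let e : (X.restrict C).carrier ≃ (ofSet (X.imgOf C i)).carrier :=
    Equiv.ofBijective (fun a : C => ⟨X.chart i ⟨a.1, hCi a.2⟩, _, a.2, rfl⟩) (by
      constructor
      · intro a b hab
        exact Subtype.ext (congrArg (fun p : X.dom i => p.1) (hX.inj i (congrArg Subtype.val hab)))
      · rintro ⟨_, ⟨a, ha⟩, haC, rfl⟩
        exact ⟨⟨a, haC⟩, rfl⟩)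
  have hdom : (X.restrict C).dom i = Set.univ := Set.eq_univ_of_forall fun a => hCi a.2
  have hO : ∀ U : Set (X.restrict C).carrier, IsOpen[(X.restrict C).top] U ↔
      OpenIn (X.imgOf C i) ((X.restrict C).imgOf U i) := by
    intro U
    have himg : (X.restrict C).img i = X.imgOf C i := by
      have := img_pullback (g := (Subtype.val : C → X.carrier)) i
      rwa [Subtype.range_coe] at this
    rw [← himg]
    exact ⟨fun h => (isOpen_iff_openIn hP.inj U).1 h i,
      fun h => hP.isOpen_of_subset_dom (i := i) (by rw [hdom]; exact U.subset_univ) h⟩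
  have hO' : ∀ U : Set (ofSet (X.imgOf C i)).carrier, IsOpen[(ofSet (X.imgOf C i)).top] U ↔
      OpenIn (X.imgOf C i) ((ofSet (X.imgOf C i)).imgOf U ()) := by
    intro U
    have himg : (ofSet (X.imgOf C i)).img () = X.imgOf C i := by
      ext p
      exact ⟨fun ⟨q, hq⟩ => hq ▸ q.1.2, fun hp => ⟨⟨⟨p, hp⟩, trivial⟩, rfl⟩⟩
    have hinj : ∀ k, Function.Injective ((ofSet (X.imgOf C i)).chart k) :=
      fun _ p q hpq => Subtype.ext (Subtype.ext hpq)
    refine (isOpen_iff_openIn hinj U).trans ⟨fun h => ?_, fun h _ => ?_⟩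
    · have h' := h ()
      rwa [himg] at h'
    · change OpenIn ((ofSet (X.imgOf C i)).img ()) _
      rwa [himg]
  have himg : ∀ U : Set (ofSet (X.imgOf C i)).carrier,
      (X.restrict C).imgOf (e ⁻¹' U) i = (ofSet (X.imgOf C i)).imgOf U () := by
    intro U
    ext p
    constructor
    · rintro ⟨⟨a, ha⟩, haU, rfl⟩
      exact ⟨⟨e a, trivial⟩, haU, rfl⟩
    · rintro ⟨⟨q, hq⟩, hqU, rfl⟩
      obtain ⟨a, rfl⟩ := e.surjective q
      exact ⟨⟨a, hCi a.2⟩, hqU, rfl⟩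
  have hgdef : ∀ k l : X.ι, DefSet L {p : Fin (X.dim k) ⊕ Fin (X.dim l) → M |
      p ∈ X.transGraph k l ∧ (fun j => p (Sum.inl j)) ∈ X.imgOf C k} := fun k l =>
    defSet_of_transfers (.and (hX.trans_def k l).transfers (.mem _ (hC' k).transfers))
  refine ⟨e, hC' i, ?_, ?_, ?_, ?_⟩
  · refine continuous_def.2 fun U hU => (hO _).2 ?_
    rw [himg]
    exact (hO' U).1 hU
  · refine continuous_def.2 fun U hU => (hO' _).2 ?_
    rw [← himg, ← Set.preimage_comp, e.symm_comp_self]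
    exact (hO U).1 hU
  · intro k _
    refine Eq.mpr (congrArg (DefSet L) ?_) (hgdef k i)
    ext p
    constructor
    · rintro ⟨a, h, _, rfl⟩
      exact ⟨⟨a.1, h, hCi a.2, rfl⟩, ⟨a.1, h⟩, a.2, rfl⟩
    · rintro ⟨⟨a, hk, hi, rfl⟩, h⟩
      exact ⟨⟨a, (chart_mem_imgOf hX.inj hk).1 h⟩, hk, trivial, rfl⟩
  · intro _ k
    refine Eq.mpr (congrArg (DefSet L) ?_) (hgdef i k)
    ext p
    constructor
    · rintro ⟨b, _, h, rfl⟩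
      obtain ⟨a, rfl⟩ := e.surjective b
      have hk : a.1 ∈ X.dom k := by
        rw [e.symm_apply_apply] at h
        exact h
      refine ⟨⟨a.1, hCi a.2, hk, ?_⟩, ⟨a.1, hCi a.2⟩, a.2, rfl⟩
      simp only [e.symm_apply_apply]
      rfl
    · rintro ⟨⟨a, hi, hk, rfl⟩, h⟩
      have ha : a ∈ C := (chart_mem_imgOf hX.inj hi).1 h
      let a' : (X.restrict C).carrier := ⟨a, ha⟩
      have ha' : a' ∈ (X.restrict C).dom k := hk
      refine ⟨e a', trivial, by rwa [e.symm_apply_apply], ?_⟩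
      simp only [e.symm_apply_apply]
      rfl

end

end ChartedSet

/-! ### Products. -/

section Boxes

variable {M : Type w} [LT M] {n m n' m' : ℕ}

theorem forall_box_append {l₁ r₁ : Fin n → M} {l₂ r₂ : Fin m → M} {p : Fin (n + m) → M} :
    (∀ i, Fin.append l₁ l₂ i < p i ∧ p i < Fin.append r₁ r₂ i) ↔
      (∀ i, l₁ i < p (Fin.castAdd m i) ∧ p (Fin.castAdd m i) < r₁ i) ∧
        ∀ i, l₂ i < p (Fin.natAdd n i) ∧ p (Fin.natAdd n i) < r₂ i := by
  constructor
  · intro h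
    exact ⟨fun i => by simpa using h (Fin.castAdd m i), fun i => by simpa using h (Fin.natAdd n i)⟩
  · rintro ⟨h₁, h₂⟩ i
    refine Fin.addCases (fun i => ?_) (fun i => ?_) i
    · simpa using h₁ i
    · simpa using h₂ i

theorem OpenIn.prod {A U : Set (Fin n → M)} {B V : Set (Fin m → M)} (hU : OpenIn A U)
    (hV : OpenIn B V) :
    OpenIn {p : Fin (n + m) → M | (fun i => p (Fin.castAdd m i)) ∈ A ∧
        (fun i => p (Fin.natAdd n i)) ∈ B}
      {p | (fun i => p (Fin.castAdd m i)) ∈ U ∧ (fun i => p (Fin.natAdd n i)) ∈ V} := by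
  rintro p ⟨h₁, h₂⟩
  obtain ⟨l₁, r₁, k₁, h₁⟩ := hU _ h₁
  obtain ⟨l₂, r₂, k₂, h₂⟩ := hV _ h₂
  refine ⟨Fin.append l₁ l₂, Fin.append r₁ r₂, forall_box_append.2 ⟨k₁, k₂⟩, fun q hq hqb => ?_⟩
  have := forall_box_append.1 hqb
  exact ⟨h₁ _ hq.1 this.1, h₂ _ hq.2 this.2⟩

theorem ContGraph.prod {G : Set (Fin n ⊕ Fin n' → M)} {H : Set (Fin m ⊕ Fin m' → M)}
    (hG : ContGraph G) (hH : ContGraph H) :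
    ContGraph {p : Fin (n + m) ⊕ Fin (n' + m') → M |
      Sum.elim (fun i => p (Sum.inl (Fin.castAdd m i)))
        (fun i => p (Sum.inr (Fin.castAdd m' i))) ∈ G ∧
      Sum.elim (fun i => p (Sum.inl (Fin.natAdd n i)))
        (fun i => p (Sum.inr (Fin.natAdd n' i))) ∈ H} := by
  rintro p q ⟨h₁, h₂⟩ l r hlr
  obtain ⟨l₁, r₁, k₁, h₁⟩ := hG _ _ h₁ (fun i => l (Fin.castAdd m' i))
    (fun i => r (Fin.castAdd m' i)) fun i => hlr _
  obtain ⟨l₂, r₂, k₂, h₂⟩ := hH _ _ h₂ (fun i => l (Fin.natAdd n' i))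
    (fun i => r (Fin.natAdd n' i)) fun i => hlr _
  refine ⟨Fin.append l₁ l₂, Fin.append r₁ r₂, forall_box_append.2 ⟨k₁, k₂⟩, ?_⟩
  rintro p' q' ⟨hG', hH'⟩ hb i
  obtain ⟨b₁, b₂⟩ := forall_box_append.1 hb
  exact Fin.addCases (h₁ _ _ hG' b₁) (h₂ _ _ hH' b₂) i

end Boxes

namespace ChartedSet

variable {L : FirstOrder.Language.{u, v}} {M : Type w} [L.Structure M]
  {X : ChartedSet.{w, x} M} {Y : ChartedSet.{w, y} M}

theorem append_eq_iff {n m : ℕ} {a : Fin n → M} {b : Fin m → M} {p : Fin (n + m) → M} :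
    Fin.append a b = p ↔ a = (fun i => p (Fin.castAdd m i)) ∧ b = fun i => p (Fin.natAdd n i) := by
  constructor
  · rintro rfl
    simp
  · rintro ⟨rfl, rfl⟩
    exact Fin.append_castAdd_natAdd

theorem imgOf_prod (U : Set X.carrier) (V : Set Y.carrier) (i : X.ι) (j : Y.ι) :
    (X.prod Y).imgOf (U ×ˢ V) (i, j) =
      {p : Fin (X.dim i + Y.dim j) → M | (fun k => p (Fin.castAdd (Y.dim j) k)) ∈ X.imgOf U i ∧
        (fun k => p (Fin.natAdd (X.dim i) k)) ∈ Y.imgOf V j} := by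
  ext p
  constructor
  · rintro ⟨⟨⟨a, b⟩, ha, hb⟩, ⟨haU, hbV⟩, h⟩
    obtain ⟨h₁, h₂⟩ := append_eq_iff.1 h
    exact ⟨⟨⟨a, ha⟩, haU, h₁⟩, ⟨⟨b, hb⟩, hbV, h₂⟩⟩
  · rintro ⟨⟨⟨a, ha⟩, haU, h₁⟩, ⟨⟨b, hb⟩, hbV, h₂⟩⟩
    exact ⟨⟨(a, b), ha, hb⟩, ⟨haU, hbV⟩, append_eq_iff.2 ⟨h₁, h₂⟩⟩

theorem img_prod (i : X.ι) (j : Y.ι) :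
    (X.prod Y).img (i, j) =
      {p : Fin (X.dim i + Y.dim j) → M | (fun k => p (Fin.castAdd (Y.dim j) k)) ∈ X.img i ∧
        (fun k => p (Fin.natAdd (X.dim i) k)) ∈ Y.img j} := by
  have e : (Set.univ : Set (X.carrier × Y.carrier)) = Set.univ ×ˢ Set.univ :=
    Set.univ_prod_univ.symm
  refine (imgOf_univ (X.prod Y) (i, j)).symm.trans
    ((congrArg (fun U => (X.prod Y).imgOf U (i, j)) e).trans ?_)
  rw [imgOf_prod, imgOf_univ, imgOf_univ]

theorem transGraph_prod (i i' : X.ι) (j j' : Y.ι) :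
    (X.prod Y).transGraph (i, j) (i', j') =
      {p : Fin (X.dim i + Y.dim j) ⊕ Fin (X.dim i' + Y.dim j') → M |
        Sum.elim (fun k => p (Sum.inl (Fin.castAdd (Y.dim j) k)))
          (fun k => p (Sum.inr (Fin.castAdd (Y.dim j') k))) ∈ X.transGraph i i' ∧
        Sum.elim (fun k => p (Sum.inl (Fin.natAdd (X.dim i) k)))
          (fun k => p (Sum.inr (Fin.natAdd (X.dim i') k))) ∈ Y.transGraph j j'} := by
  ext p
  constructor
  · rintro ⟨⟨a, b⟩, ⟨ha, hb⟩, ⟨ha', hb'⟩, rfl⟩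
    refine ⟨⟨a, ha, ha', ?_⟩, ⟨b, hb, hb', ?_⟩⟩ <;> ext (k | k) <;> simp [prod]
  · rintro ⟨h₁, h₂⟩
    obtain ⟨a, ha, ha', h₃, h₄⟩ := elim_mem_transGraph.1 h₁
    obtain ⟨b, hb, hb', h₅, h₆⟩ := elim_mem_transGraph.1 h₂
    refine ⟨(a, b), ⟨ha, hb⟩, ⟨ha', hb'⟩, ?_⟩
    refine (Sum.elim_comp_inl_inr p).symm.trans (Sum.elim_eq_iff.2 ⟨?_, ?_⟩)
    · exact (append_eq_iff.2 ⟨h₃, h₅⟩).symm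
    · exact (append_eq_iff.2 ⟨h₄, h₆⟩).symm

/-- Serves as the idle member of the pair when a property depends on only one of the two spaces. -/
theorem isClosedAffine_empty [TopologicalSpace M] : X.IsClosedAffine L ∅ := by
  refine ⟨.empty, @isClosed_empty _ X.top, 0, ∅,
    ⟨fun a => a.2.elim, fun a => a.2.elim, fun a => a.2.elim, fun a => a.2.elim⟩, Set.definable_empty, ?_, ?_, ?_, ?_⟩
  · refine continuous_def.2 fun U _ => ?_
    rw [Set.eq_empty_of_forall_notMem (s := _ ⁻¹' U) fun a => a.2.elim]
    exact @isOpen_empty _ (X.restrict ∅).top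
  · refine continuous_def.2 fun U _ => ?_
    rw [Set.eq_empty_of_forall_notMem (s := _ ⁻¹' U) fun a => a.2.elim]
    exact @isOpen_empty _ (ofSet ∅).top
  · intro i j
    refine Eq.mpr (congrArg (DefSet L) (Set.eq_empty_of_forall_notMem ?_)) Set.definable_empty
    rintro p ⟨a, -⟩
    exact a.2
  · intro i j
    refine Eq.mpr (congrArg (DefSet L) (Set.eq_empty_of_forall_notMem ?_)) Set.definable_empty
    rintro p ⟨a, -⟩
    exact a.2

variable [LinearOrder M] [NoMinOrder M] [NoMaxOrder M] [TopologicalSpace M] [OrderTopology M]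

theorem IsDefinableSpace.prod (hX : X.IsDefinableSpace L) (hY : Y.IsDefinableSpace L) :
    (X.prod Y).IsDefinableSpace L := by
  refine isDefinableSpace_of_graphs ?_ ?_ ?_ ?_ ?_ ?_
  · rintro ⟨a, b⟩
    obtain ⟨i, hi⟩ := hX.cover a
    obtain ⟨j, hj⟩ := hY.cover b
    exact ⟨(i, j), hi, hj⟩
  · rintro ⟨i, j⟩ ⟨⟨a, b⟩, ha, hb⟩ ⟨⟨a', b'⟩, ha', hb'⟩ h
    obtain ⟨h₁, h₂⟩ := append_eq_iff.1 h
    have h₃ : X.chart i ⟨a, ha⟩ = X.chart i ⟨a', ha'⟩ := h₁.trans (by simp [ChartedSet.prod])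
    have h₄ : Y.chart j ⟨b, hb⟩ = Y.chart j ⟨b', hb'⟩ := h₂.trans (by simp [ChartedSet.prod])
    obtain rfl : a = a' := congrArg Subtype.val (hX.inj i h₃)
    obtain rfl : b = b' := congrArg Subtype.val (hY.inj j h₄)
    rfl
  · rintro ⟨i, j⟩
    rw [img_prod]
    exact defSet_of_transfers (.and (.mem _ (hX.img_def i).transfers)
      (.mem _ (hY.img_def j).transfers))
  · rintro ⟨i, j⟩ ⟨i', j'⟩
    rw [transGraph_prod]
    exact defSet_of_transfers (.and (.mem_elim _ _ (hX.trans_def i i').transfers)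
      (.mem_elim _ _ (hY.trans_def j j').transfers))
  · rintro ⟨i, j⟩ ⟨i', j'⟩
    rw [img_prod]
    exact imgOf_prod (X.dom i') (Y.dom j') i j ▸
      (hX.openIn_overlap i i').prod (hY.openIn_overlap j j')
  · rintro ⟨i, j⟩ ⟨i', j'⟩
    rw [transGraph_prod]
    exact (hX.contGraph i i').prod (hY.contGraph j j')

theorem DefOpen.prod (hX : X.IsDefinableSpace L) (hY : Y.IsDefinableSpace L)
    {U : Set X.carrier} {V : Set Y.carrier} (hU : X.DefOpen L U) (hV : Y.DefOpen L V) :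
    (X.prod Y).DefOpen L (U ×ˢ V) := by
  constructor
  · rintro ⟨i, j⟩
    rw [imgOf_prod]
    exact defSet_of_transfers (.and (.mem _ (hU.1 i).transfers) (.mem _ (hV.1 j).transfers))
  · refine (isOpen_iff_openIn (hX.prod hY).inj _).2 ?_
    rintro ⟨i, j⟩
    rw [img_prod, imgOf_prod]
    exact ((isOpen_iff_openIn hX.inj U).1 hU.2 i).prod ((isOpen_iff_openIn hY.inj V).1 hV.2 j)

theorem DefOpen.compl_prod (hX : X.IsDefinableSpace L) (hY : Y.IsDefinableSpace L)
    {C : Set X.carrier} {D : Set Y.carrier} (hC : X.DefOpen L Cᶜ) (hD : Y.DefOpen L Dᶜ) :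
    (X.prod Y).DefOpen L (C ×ˢ D)ᶜ := by
  exact Eq.mpr (congrArg ((X.prod Y).DefOpen L) (Set.compl_prod_eq_union C D))
    ((hC.prod hX hY (.univ hY)).union (DefOpen.prod hX hY (.univ hX) hD))

/-- Normality of the product can be tested on the products of the members of closed covers. -/
theorem IsDefinableSpace.prod_isDefinablyNormal (hX : X.IsDefinableSpace L)
    (hY : Y.IsDefinableSpace L) {κ κ' : Type*} [Finite κ] [Finite κ'] {C : κ → Set X.carrier}
    {D : κ' → Set Y.carrier} (hC : ∀ k, X.DefOpen L (C k)ᶜ) (hD : ∀ k, Y.DefOpen L (D k)ᶜ)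
    (hCX : ⋃ k, C k = Set.univ) (hDY : ⋃ k, D k = Set.univ)
    (h : ∀ k k', SepNormal (((X.restrict (C k)).prod (Y.restrict (D k'))).DefOpen L)) :
    (X.prod Y).IsDefinablyNormal L := by
  refine (hX.prod hY).isDefinablyNormal_of_closed_cover (κ := κ × κ')
    (c := fun k => C k.1 × D k.2)
    (fun k => (Prod.map Subtype.val Subtype.val : C k.1 × D k.2 → X.carrier × Y.carrier))
    (fun k => Subtype.val_injective.prodMap Subtype.val_injective) (fun k => ?_) ?_
    -- The product of two restrictions is definitionally the pullback of the product along the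
    -- product of the inclusions.
    (fun k => h k.1 k.2)
  · have e : Set.range (Prod.map Subtype.val Subtype.val : C k.1 × D k.2 → _) = C k.1 ×ˢ D k.2 := by
      rw [Set.range_prodMap, Subtype.range_coe, Subtype.range_coe]
    exact Eq.mpr (congrArg (fun U => (X.prod Y).DefOpen L Uᶜ) e)
      (DefOpen.compl_prod hX hY (hC _) (hD _))
  · rintro ⟨a, b⟩
    obtain ⟨k, hk⟩ := Set.mem_iUnion.1 (hCX.symm ▸ Set.mem_univ a)
    obtain ⟨k', hk'⟩ := Set.mem_iUnion.1 (hDY.symm ▸ Set.mem_univ b)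
    exact ⟨(k, k'), (⟨a, hk⟩, ⟨b, hk'⟩), rfl⟩

end ChartedSet

/-! ### Gauges, and separation by balls. -/

section Gauge

/-- A definable ternary relation `E (z, a, ε)`, to be read as "`z` is `ε`-close to `a`", with the
properties of closeness needed to separate disjoint relatively closed sets. -/
structure IsGauge (L : FirstOrder.Language.{u, v}) {M : Type w} [L.Structure M] [LinearOrder M]
    (E : Set (Fin 3 → M)) : Prop where
  nonempty : Nonempty M
  definable : DefSet L E
  isOpen : ∀ z a ε : M, ![z, a, ε] ∈ E → ∃ l r, (l < z ∧ z < r) ∧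
    ∀ z', l < z' → z' < r → ![z', a, ε] ∈ E
  mono : ∀ z a δ ε : M, δ ≤ ε → ![z, a, δ] ∈ E → ![z, a, ε] ∈ E
  small : ∀ l a r : M, l < a → a < r → ∃ ε, ![a, a, ε] ∈ E ∧
    ∀ b z, ![z, a, ε] ∈ E → ![z, b, ε] ∈ E → l < b ∧ b < r
  refl : ∀ a b ε : M, ![a, a, ε] ∈ E → ![b, b, ε] ∈ E

variable {L : FirstOrder.Language.{u, v}} {M : Type w} [L.Structure M] [LinearOrder M]

/-- Apart from nonemptiness and definability, each clause is a single first-order sentence about `E`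
and the order. -/
theorem IsGauge.transfer [L.IsOrdered] [L.OrderedStructure M] {S : Type w'} [L.Structure S]
    [LinearOrder S] [L.OrderedStructure S] (f : M ↪ₑ[L] S) {E : Set (Fin 3 → M)}
    (h : IsGauge L E) : IsGauge L (extSet f E) := by
  have hE := transfers_extSet (f := f) h.definable
  refine ⟨h.nonempty.map f, hE.defSet_right, ?_, ?_, ?_, ?_⟩
  · refine (Transfers.sentence_iff (f := f) ?_).1 h.isOpen
    refine .all_one <| .all_one <| .all_one <| .imp (.mem_vec _ _ _ hE) <| .ex_one <| .ex_one <|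
      .and (.and (.lt _ _) (.lt _ _)) <| .all_one <| .imp (.lt _ _) <| .imp (.lt _ _) <|
      .mem_vec _ _ _ hE
  · refine (Transfers.sentence_iff (f := f) ?_).1 h.mono
    exact .all_one <| .all_one <| .all_one <| .all_one <| .imp (.le _ _) <|
      .imp (.mem_vec _ _ _ hE) (.mem_vec _ _ _ hE)
  · refine (Transfers.sentence_iff (f := f) ?_).1 h.small
    exact .all_one <| .all_one <| .all_one <| .imp (.lt _ _) <| .imp (.lt _ _) <| .ex_one <|
      .and (.mem_vec _ _ _ hE) <| .all_one <| .all_one <| .imp (.mem_vec _ _ _ hE) <|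
      .imp (.mem_vec _ _ _ hE) <| .and (.lt _ _) (.lt _ _)
  · refine (Transfers.sentence_iff (f := f) ?_).1 h.refl
    exact .all_one <| .all_one <| .all_one <| .imp (.mem_vec _ _ _ hE) (.mem_vec _ _ _ hE)

/-- The gauge is `z < a + ε ∧ a < z + ε`, a form of `|z - a| < ε` that works without commutativity.
-/
theorem ExpandsOrderedGroup.exists_isGauge [L.IsOrdered] [L.OrderedStructure M]
    [DenselyOrdered M] [NoMaxOrder M] (h : ExpandsOrderedGroup L M) :
    ∃ E : Set (Fin 3 → M), IsGauge L E := by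
  obtain ⟨_, hle, hdef⟩ := h
  have : AddLeftMono M := ⟨fun c a b hab => (hle a b c hab).1⟩
  have : AddRightMono M := ⟨fun c a b hab => (hle a b c hab).2⟩
  have hE : DefSet L {p : Fin 3 → M |
      (∃ s, ![p 1, p 2, s] ∈ {p : Fin 3 → M | p 0 + p 1 = p 2} ∧ p 0 < s) ∧
        ∃ s, ![p 0, p 2, s] ∈ {p : Fin 3 → M | p 0 + p 1 = p 2} ∧ p 1 < s} :=
    defSet_of_transfers (.and
      (.ex_one (.and (.mem_vec _ _ _ hdef.transfers) (.lt _ _)))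
      (.ex_one (.and (.mem_vec _ _ _ hdef.transfers) (.lt _ _))))
  refine ⟨_, ⟨0⟩, hE, ?_, ?_, ?_, ?_⟩ <;>
    simp only [Set.mem_ofPred_eq, Matrix.cons_val_zero, Matrix.cons_val_one, Matrix.cons_val,
      exists_eq_left']
  · rintro z a ε ⟨h₁, h₂⟩
    exact ⟨a - ε, a + ε, ⟨sub_lt_iff_lt_add.2 h₂, h₁⟩, fun z' h₃ h₄ =>
      ⟨h₄, sub_lt_iff_lt_add.1 h₃⟩⟩
  · rintro z a δ ε hδ ⟨h₁, h₂⟩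
    exact ⟨h₁.trans_le (by gcongr), h₂.trans_le (by gcongr)⟩
  · intro l a r hl hr
    -- Any `ε` with `ε + ε` at most this bound works. Division by two is replaced by density: choose
    -- `η` strictly between `0` and the bound `d`, and let `ε` be the smaller of `η` and `-η + d`.
    have hd : 0 < min (-a + r) (-l + a) :=
      lt_min (lt_neg_add_iff_add_lt.2 (by simpa)) (lt_neg_add_iff_add_lt.2 (by simpa))
    obtain ⟨η, hη, hηd⟩ := exists_between hd
    obtain ⟨hη₁, hη₂⟩ : 0 < η ∧ 0 < -η + min (-a + r) (-l + a) :=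
      ⟨hη, lt_neg_add_iff_add_lt.2 (by simpa using hηd)⟩
    set ε := min η (-η + min (-a + r) (-l + a)) with hε
    have hε₀ : 0 < ε := lt_min hη₁ hη₂
    have hεd : ε + ε ≤ min (-a + r) (-l + a) := by
      calc ε + ε ≤ η + (-η + min (-a + r) (-l + a)) :=
            add_le_add (min_le_left _ _) (min_le_right _ _)
        _ = _ := by rw [add_neg_cancel_left]
    have h₁ : a + (ε + ε) ≤ r := le_neg_add_iff_add_le.1 (hεd.trans (min_le_left _ _))
    have h₂ : l + (ε + ε) ≤ a := le_neg_add_iff_add_le.1 (hεd.trans (min_le_right _ _))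
    refine ⟨ε, by simpa using hε₀, ?_⟩
    rintro b z ⟨k₁, k₂⟩ ⟨k₃, k₄⟩
    constructor
    -- Through the common point, `l + (ε + ε) ≤ a < z + ε < b + ε + ε`; the upper bound is
    -- symmetric.
    · have : l + (ε + ε) < b + (ε + ε) := by
        refine h₂.trans_lt (k₂.trans ?_)
        rw [← add_assoc]
        gcongr
      exact lt_of_add_lt_add_right this
    · refine k₄.trans (lt_of_lt_of_le ?_ h₁)
      rw [← add_assoc]
      gcongr
  · intro a b ε h
    simpa using h

/-- The union of the `ε`-balls with centre `a` in `A` that meet no `ε`-ball with centre in `B`. -/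
def nearSet {n : ℕ} (E : Set (Fin 3 → M)) (A B : Set (Fin n → M)) : Set (Fin n → M) :=
  {z | ∃ a, a ∈ A ∧ ∃ ε : M, (∀ i, ![z i, a i, ε] ∈ E) ∧ ∀ b, b ∈ B →
    ¬ ∃ z' : Fin n → M, (∀ i, ![z' i, a i, ε] ∈ E) ∧ ∀ i, ![z' i, b i, ε] ∈ E}

namespace IsGauge

variable {E : Set (Fin 3 → M)} (hE : IsGauge L E) {n : ℕ} {A B : Set (Fin n → M)}
include hE

theorem definable_nearSet (hA : DefSet L A) (hB : DefSet L B) : DefSet L (nearSet E A B) := by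
  refine defSet_of_transfers <| .ex <| .and (.mem _ hA.transfers) <| .ex_one <| .and
    (.forall_index fun i => .mem_vec _ _ _ hE.definable.transfers) <| .all <| .imp ?_ <| .not <|
    .ex <| .and ?_ ?_
  · exact .mem _ hB.transfers
  · exact .forall_index fun i => .mem_vec _ _ _ hE.definable.transfers
  · exact .forall_index fun i => .mem_vec _ _ _ hE.definable.transfers

/-- Of the two balls containing a common point, enlarge the one of smaller radius to the larger
radius. The balls still share that point, against the choice of the larger ball. -/
theorem disjoint_nearSet : Disjoint (nearSet E A B) (nearSet E B A) := by
  rw [Set.disjoint_left]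
  rintro z ⟨a, ha, ε, h₁, h₂⟩ ⟨b, hb, δ, h₃, h₄⟩
  rcases le_total δ ε with h | h
  · exact h₂ b hb ⟨z, h₁, fun i => hE.mono _ _ _ _ h (h₃ i)⟩
  · exact h₄ a ha ⟨z, h₃, fun i => hE.mono _ _ _ _ h (h₁ i)⟩

theorem openIn_nearSet (D : Set (Fin n → M)) : OpenIn D (nearSet E A B ∩ D) := by
  rintro z ⟨⟨a, ha, ε, h₁, h₂⟩, -⟩
  choose l r h₃ h₄ using fun i => hE.isOpen _ _ _ (h₁ i)
  exact ⟨l, r, h₃, fun y hy hyb => ⟨⟨a, ha, ε, fun i => h₄ i _ (hyb i).1 (hyb i).2, h₂⟩, hy⟩⟩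

/-- Some box around `a` misses `B`. In each coordinate `small` gives a radius for which every centre
whose ball meets that of `a` stays in the box, and the least of these radii serves all coordinates.
-/
theorem subset_nearSet {D : Set (Fin n → M)} (hB : B ⊆ D) (hAB : Disjoint A B)
    (hAD : A ⊆ D) (h : OpenIn D (D \ B)) : A ⊆ nearSet E A B := by
  intro a ha
  obtain ⟨l, r, h₁, h₂⟩ := h a ⟨hAD ha, Set.disjoint_left.1 hAB ha⟩
  choose ε h₃ h₄ using fun i => hE.small _ _ _ (h₁ i).1 (h₁ i).2
  obtain ⟨ε₀, h₅, h₆⟩ : ∃ ε₀ : M, (∀ i, ![a i, a i, ε₀] ∈ E) ∧ ∀ i, ε₀ ≤ ε i := by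
    -- In dimension zero there is no least radius, and any element of `M` will do.
    rcases isEmpty_or_nonempty (Fin n) with hn | hn
    · obtain ⟨e⟩ := hE.nonempty
      exact ⟨e, fun i => isEmptyElim i, fun i => isEmptyElim i⟩
    · obtain ⟨k, hk⟩ := Finite.exists_min ε
      exact ⟨ε k, fun i => hE.refl _ _ _ (h₃ k), hk⟩
  refine ⟨a, ha, ε₀, h₅, ?_⟩
  rintro b hb ⟨z, h₇, h₈⟩
  refine (h₂ b (hB hb) fun i => h₄ i _ (z i) ?_ ?_).2 hb
  · exact hE.mono _ _ _ _ (h₆ i) (h₇ i)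
  · exact hE.mono _ _ _ _ (h₆ i) (h₈ i)

end IsGauge

end Gauge

/-! ### Normality from a gauge, and traces of a subspace on a closed cover. -/

namespace ChartedSet

variable {L : FirstOrder.Language.{u, v}} {M : Type w} [L.Structure M]
  {X : ChartedSet.{w, x} M}

theorem IsDefSubset.restrict [TopologicalSpace M] (hX : X.IsDefinableSpace L) {A B : Set X.carrier}
    (hA : X.IsDefSubset L A) (hB : X.IsDefSubset L B) :
    (X.restrict A).IsDefSubset L {a | a.1 ∈ B} := fun i => by
  have e : Subtype.val '' {a : A | a.1 ∈ B} = B ∩ A := by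
    ext a
    simp [and_comm]
  exact Eq.mpr (congrArg (DefSet L) ((imgOf_pullback (g := (Subtype.val : A → X.carrier)) _ i).trans
    (congrArg (fun U => X.imgOf U i) e))) (hB.inter hX hA i)

variable [LinearOrder M] [NoMinOrder M] [NoMaxOrder M] [TopologicalSpace M] [OrderTopology M]

/-- One chart covers the space, so the separating sets are the preimages of the two `nearSet`s of
the chart images. -/
theorem IsDefinableSpace.sepNormal_of_isGauge {E : Set (Fin 3 → M)} (hE : IsGauge L E)
    (hX : X.IsDefinableSpace L) {i : X.ι} (hi : ∀ a, a ∈ X.dom i) : SepNormal (X.DefOpen L) := by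
  intro Z₁ Z₂ h₁ h₂ hdis
  have hd₁ : X.IsDefSubset L Z₁ := by simpa using h₁.1.compl hX
  have hd₂ : X.IsDefSubset L Z₂ := by simpa using h₂.1.compl hX
  have ho : ∀ Z, X.DefOpen L Zᶜ → OpenIn (X.img i) (X.img i \ X.imgOf Z i) := fun Z hZ => by
    rw [← imgOf_compl hX.inj]
    exact (isOpen_iff_openIn hX.inj _).1 hZ.2 i
  have hdis' : Disjoint (X.imgOf Z₁ i) (X.imgOf Z₂ i) := by
    rw [Set.disjoint_left]
    rintro _ ⟨⟨a, ha⟩, ha₁, rfl⟩ h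
    exact Set.disjoint_left.1 hdis ha₁ ((chart_mem_imgOf hX.inj ha).1 h)
  have key : ∀ W : Set (Fin (X.dim i) → M), X.imgOf {a | X.chart i ⟨a, hi a⟩ ∈ W} i =
      W ∩ X.img i := by
    intro W
    ext p
    constructor
    · rintro ⟨⟨a, ha⟩, haW, rfl⟩
      exact ⟨haW, _, rfl⟩
    · rintro ⟨hp, ⟨a, ha⟩, rfl⟩
      exact ⟨_, hp, rfl⟩
  have hdo : ∀ W : Set (Fin (X.dim i) → M), DefSet L W → OpenIn (X.img i) (W ∩ X.img i) →
      X.DefOpen L {a | X.chart i ⟨a, hi a⟩ ∈ W} := fun W hW hWo =>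
    ⟨.of_subset_dom hX (fun a _ => hi a) (by rw [key]; exact hW.inter (hX.img_def i)),
      hX.isOpen_of_subset_dom (fun a _ => hi a) (by rwa [key])⟩
  refine ⟨_, _, hdo _ (hE.definable_nearSet (hd₁ i) (hd₂ i)) (hE.openIn_nearSet _),
    hdo _ (hE.definable_nearSet (hd₂ i) (hd₁ i)) (hE.openIn_nearSet _), ?_, ?_, ?_⟩
  · rw [Set.disjoint_left]
    exact fun a ha ha' => Set.disjoint_left.1 hE.disjoint_nearSet ha ha'
  · exact fun a ha => hE.subset_nearSet (imgOf_subset_img _ _ _) hdis' (imgOf_subset_img _ _ _)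
      (ho _ h₂) ⟨⟨a, hi a⟩, ha, rfl⟩
  · exact fun a ha => hE.subset_nearSet (imgOf_subset_img _ _ _) hdis'.symm
      (imgOf_subset_img _ _ _) (ho _ h₁) ⟨⟨a, hi a⟩, ha, rfl⟩

/-- The gauge separates inside each `C i`, which lies in one chart, and the closed cover glues. In
the ordered group case all the conclusions follow from this by choosing the cover. -/
theorem IsDefinableSpace.isDefinablyNormal_of_isGauge {E : Set (Fin 3 → M)} (hE : IsGauge L E)
    (hX : X.IsDefinableSpace L) {C : X.ι → Set X.carrier} (hC : ∀ i, X.DefOpen L (C i)ᶜ)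
    (hCi : ∀ i, C i ⊆ X.dom i) (hCX : ⋃ i, C i = Set.univ) : X.IsDefinablyNormal L := by
  have := X.fin
  refine hX.isDefinablyNormal_of_closed_cover (c := fun i => C i) (fun i => Subtype.val)
    (fun i => Subtype.val_injective) (by simpa using hC) (fun a => ?_) fun i => ?_
  · obtain ⟨i, hi⟩ := Set.mem_iUnion.1 (hCX.symm ▸ Set.mem_univ a)
    exact ⟨i, ⟨a, hi⟩, rfl⟩
  · exact (hX.pullback Subtype.val_injective
      (by simpa using (hC i).1.compl hX)).sepNormal_of_isGauge hE (i := i) fun a => hCi i a.2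

/-- Normality of a definable subspace can be tested on its traces on the members of a closed
cover. -/
theorem IsDefinableSpace.restrict_isDefinablyNormal (hX : X.IsDefinableSpace L) {κ : Type*}
    [Finite κ] {C : κ → Set X.carrier} (hC : ∀ k, X.DefOpen L (C k)ᶜ)
    (hCX : ⋃ k, C k = Set.univ) {Z : Set X.carrier} (hZ : X.IsDefSubset L Z)
    (h : ∀ k, SepNormal (((X.restrict (C k)).restrict {a | a.1 ∈ Z}).DefOpen L)) :
    (X.restrict Z).IsDefinablyNormal L := by
  have hR : X.IsDefSubset L (Set.range (Subtype.val : Z → X.carrier)) := by simpa using hZ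
  have hXZ := hX.pullback Subtype.val_injective hR
  -- The trace `Z ∩ C k` has definitionally the same charts inside `Z` as inside `C k`, so `h`
  -- applies as it stands.
  refine IsDefinableSpace.isDefinablyNormal_of_closed_cover hXZ
    (c := fun k => {a : C k | a.1 ∈ Z}) (fun k a => ⟨a.1.1, a.2⟩) ?_ (fun k => ?_) ?_ h
  · rintro k ⟨⟨a, ha⟩, ha'⟩ ⟨⟨b, hb⟩, hb'⟩ hab
    obtain rfl : a = b := congrArg Subtype.val hab
    rfl
  · have := (hC k).preimage hX Subtype.val_injective hR
    have e : Set.range (fun a : {a : C k | a.1 ∈ Z} => (⟨a.1.1, a.2⟩ : Z)) =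
        Subtype.val ⁻¹' C k := by
      ext a
      exact ⟨fun ⟨b, hb⟩ => hb ▸ b.1.2, fun ha => ⟨⟨⟨a.1, ha⟩, a.2⟩, rfl⟩⟩
    exact Eq.mpr (congrArg (fun U => (X.restrict Z).DefOpen L Uᶜ) e) this
  · intro a
    obtain ⟨k, hk⟩ := Set.mem_iUnion.1 (hCX.symm ▸ Set.mem_univ a.1)
    exact ⟨k, ⟨⟨a.1, hk⟩, a.2⟩, rfl⟩

end ChartedSet

/-! ### Elementary extensions: gluing, subspaces and closed covers. -/

namespace ChartedSet

theorem mk_eq_pullback {M : Type w} {Z : ChartedSet.{w, x} M} {c : Type y} (g : c → Z.carrier)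
    (dom : Z.ι → Set c) (chart : ∀ i, dom i → (Fin (Z.dim i) → M))
    (hdom : ∀ i a, a ∈ dom i ↔ g a ∈ Z.dom i)
    (hchart : ∀ i a (h : a ∈ dom i) (h' : g a ∈ Z.dom i), chart i ⟨a, h⟩ = Z.chart i ⟨g a, h'⟩) :
    (⟨c, Z.ι, Z.fin, Z.dim, dom, chart⟩ : ChartedSet.{w, y} M) = Z.pullback g := by
  obtain rfl : dom = fun i => g ⁻¹' Z.dom i := funext fun i => Set.ext (hdom i)
  obtain rfl : chart = fun i p => Z.chart i ⟨g p.1, p.2⟩ :=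
    funext fun i => funext fun p => hchart i p.1 p.2 p.2
  rfl

variable {L : FirstOrder.Language.{u, v}} {M : Type w} {S : Type w'} [L.Structure M]
  [L.Structure S] {f : M ↪ₑ[L] S} {X : ChartedSet.{w, x} M}

section Gluing

variable [TopologicalSpace M] (hX : X.IsDefinableSpace L)
include hX

theorem IsDefinableSpace.transfers_img (i : X.ι) :
    Transfers f (· ∈ X.img i) (· ∈ extSet f (X.img i)) :=
  transfers_extSet (hX.img_def i)

theorem IsDefinableSpace.transfers_transGraph (i j : X.ι) :
    Transfers f (· ∈ X.transGraph i j) (· ∈ extSet f (X.transGraph i j)) :=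
  transfers_extSet (hX.trans_def i j)

/-- This and the next statements are first-order properties of the transition graphs, evident in `M`
where points of `X` witness them, and transferred to `S`. -/
theorem IsDefinableSpace.ext_refl {i : X.ι} :
    ∀ p, p ∈ extSet f (X.img i) → Sum.elim p p ∈ extSet f (X.transGraph i i) := by
  refine (Transfers.forall_iff (f := f)
    (.imp (hX.transfers_img i) (.mem_elim _ _ (hX.transfers_transGraph i i)))).1 ?_
  rintro _ ⟨⟨a, ha⟩, rfl⟩
  exact ⟨a, ha, ha, rfl⟩

theorem IsDefinableSpace.ext_diag {i : X.ι} :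
    ∀ p q, Sum.elim p q ∈ extSet f (X.transGraph i i) → p = q := by
  have h : ∀ p q, Sum.elim p q ∈ X.transGraph i i → p = q := by
    intro p q h
    obtain ⟨a, ha, ha', rfl, rfl⟩ := elim_mem_transGraph.1 h
    rfl
  refine (Transfers.forall_iff (f := f) ?_).1 h
  exact .all (.imp (.mem_elim _ _ (hX.transfers_transGraph i i)) (.eq_block _ _))

theorem IsDefinableSpace.ext_symm {i j : X.ι} :
    ∀ p q, Sum.elim p q ∈ extSet f (X.transGraph i j) →
      Sum.elim q p ∈ extSet f (X.transGraph j i) := by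
  have h : ∀ p q, Sum.elim p q ∈ X.transGraph i j → Sum.elim q p ∈ X.transGraph j i := by
    intro p q h
    obtain ⟨a, ha, ha', rfl, rfl⟩ := elim_mem_transGraph.1 h
    exact ⟨a, ha', ha, rfl⟩
  refine (Transfers.forall_iff (f := f) ?_).1 h
  exact .all (.imp (.mem_elim _ _ (hX.transfers_transGraph i j))
      (.mem_elim _ _ (hX.transfers_transGraph j i)))

theorem IsDefinableSpace.ext_trans {i j k : X.ι} :
    ∀ p q r, Sum.elim p q ∈ extSet f (X.transGraph i j) →
      Sum.elim q r ∈ extSet f (X.transGraph j k) →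
      Sum.elim p r ∈ extSet f (X.transGraph i k) := by
  have h : ∀ p q r, Sum.elim p q ∈ X.transGraph i j → Sum.elim q r ∈ X.transGraph j k →
      Sum.elim p r ∈ X.transGraph i k := by
    intro p q r h h'
    obtain ⟨a, ha, ha', rfl, rfl⟩ := elim_mem_transGraph.1 h
    obtain ⟨ha'', rfl⟩ := (chart_mem_transGraph hX.inj ha').1 h'
    exact ⟨a, ha, ha'', rfl⟩
  refine (Transfers.forall_iff (f := f) ?_).1 h
  exact .all (.all (.imp (.mem_elim _ _ (hX.transfers_transGraph i j))
      (.imp (.mem_elim _ _ (hX.transfers_transGraph j k))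
      (.mem_elim _ _ (hX.transfers_transGraph i k)))))

theorem IsDefinableSpace.ext_mem_img {i j : X.ι} :
    ∀ p q, Sum.elim p q ∈ extSet f (X.transGraph i j) → p ∈ extSet f (X.img i) := by
  have h : ∀ p q, Sum.elim p q ∈ X.transGraph i j → p ∈ X.img i := by
    intro p q h
    obtain ⟨a, ha, ha', rfl, rfl⟩ := elim_mem_transGraph.1 h
    exact ⟨_, rfl⟩
  refine (Transfers.forall_iff (f := f) ?_).1 h
  exact .all (.imp (.mem_elim _ _ (hX.transfers_transGraph i j)) (.mem _ (hX.transfers_img i)))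

theorem IsDefinableSpace.ext_imgOf_subset {D : Set X.carrier} (hD : X.IsDefSubset L D) {i : X.ι} :
    ∀ p, p ∈ extSet f (X.imgOf D i) → p ∈ extSet f (X.img i) :=
  (Transfers.forall_iff (f := f)
    (.imp (transfers_extSet (hD i)) (hX.transfers_img i))).1 fun _ h => imgOf_subset_img _ _ _ h

theorem IsDefinableSpace.ext_mem_imgOf {D : Set X.carrier} (hD : X.IsDefSubset L D) {i j : X.ι} :
    ∀ p q, Sum.elim p q ∈ extSet f (X.transGraph i j) → p ∈ extSet f (X.imgOf D i) →
      q ∈ extSet f (X.imgOf D j) := by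
  have h : ∀ p q, Sum.elim p q ∈ X.transGraph i j → p ∈ X.imgOf D i → q ∈ X.imgOf D j := by
    intro p q h h'
    obtain ⟨a, ha, ha', rfl, rfl⟩ := elim_mem_transGraph.1 h
    exact ⟨_, (chart_mem_imgOf hX.inj ha).1 h', rfl⟩
  refine (Transfers.forall_iff (f := f) ?_).1 h
  exact .all (.imp (.mem_elim _ _ (hX.transfers_transGraph i j))
      (.imp (.mem _ (transfers_extSet (hD i))) (.mem _ (transfers_extSet (hD j)))))

/-- The point of `X(S)` represented by a point of `θ_i(X_i)(S)`. -/
def extMk (f : M ↪ₑ[L] S) (X : ChartedSet.{w, x} M) (i : X.ι) (p : extSet f (X.img i)) :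
    (X.ext f).carrier :=
  Quot.mk _ ⟨i, p⟩

/-- The gluing relation is already an equivalence relation, so the quotient makes no further
identifications. -/
theorem IsDefinableSpace.extMk_eq_iff {i j : X.ι} {p : extSet f (X.img i)}
    {q : extSet f (X.img j)} :
    extMk f X i p = extMk f X j q ↔ Sum.elim p.1 q.1 ∈ extSet f (X.transGraph i j) := by
  have h : Equivalence fun a b : Σ i, extSet f (X.img i) =>
      Sum.elim (a.2 : Fin (X.dim a.1) → S) (b.2 : Fin (X.dim b.1) → S) ∈
        extSet f (X.transGraph a.1 b.1) :=
    ⟨fun a => hX.ext_refl a.2.1 a.2.2, fun {_ _} h => hX.ext_symm _ _ h,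
      fun {_ _ _} h h' => hX.ext_trans _ _ _ h h'⟩
  exact h.quot_mk_eq_iff ⟨i, p⟩ ⟨j, q⟩

/-- The chart picks a representative by choice; by `ext_diag` a point has only one in each chart. -/
theorem IsDefinableSpace.chart_ext {i : X.ι} {p : extSet f (X.img i)} {a : (X.ext f).carrier}
    (hp : extMk f X i p = a) (h : a ∈ (X.ext f).dom i) : (X.ext f).chart i ⟨a, h⟩ = p.1 :=
  hX.ext_diag _ _ (hX.extMk_eq_iff.1 ((Classical.choose_spec h).trans hp.symm))

theorem IsDefinableSpace.img_ext (i : X.ι) : (X.ext f).img i = extSet f (X.img i) := by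
  ext p
  constructor
  · rintro ⟨⟨_, q, rfl⟩, rfl⟩
    exact Eq.mpr (congrArg (· ∈ _) (hX.chart_ext (p := q) rfl ⟨q, rfl⟩)) q.2
  · intro hp
    exact ⟨⟨_, ⟨p, hp⟩, rfl⟩, hX.chart_ext (p := ⟨p, hp⟩) rfl _⟩

theorem IsDefinableSpace.elim_mem_transGraph_ext {i j : X.ι} {p : Fin (X.dim i) → S}
    {q : Fin (X.dim j) → S} : Sum.elim p q ∈ (X.ext f).transGraph i j ↔
      Sum.elim p q ∈ extSet f (X.transGraph i j) := by
  refine (elim_mem_transGraph (X := X.ext f)).trans ⟨?_, fun h => ?_⟩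
  · rintro ⟨a, ⟨p', hp'⟩, ⟨q', hq'⟩, rfl, rfl⟩
    have h := hX.extMk_eq_iff.1 (hp'.trans hq'.symm)
    rwa [← hX.chart_ext hp' ⟨p', hp'⟩, ← hX.chart_ext hq' ⟨q', hq'⟩] at h
  · have hp := hX.ext_mem_img _ _ h
    have hq := hX.ext_mem_img _ _ (hX.ext_symm _ _ h)
    have e : extMk f X i ⟨p, hp⟩ = extMk f X j ⟨q, hq⟩ := hX.extMk_eq_iff.2 h
    exact ⟨_, ⟨⟨p, hp⟩, rfl⟩, ⟨⟨q, hq⟩, e.symm⟩, hX.chart_ext (p := ⟨p, hp⟩) rfl _,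
      hX.chart_ext (p := ⟨q, hq⟩) e.symm _⟩

theorem IsDefinableSpace.transGraph_ext (i j : X.ι) :
    (X.ext f).transGraph i j = extSet f (X.transGraph i j) := by
  refine Set.ext fun p => ?_
  rw [← Sum.elim_comp_inl_inr p]
  exact hX.elim_mem_transGraph_ext

theorem IsDefinableSpace.imgOf_dom_ext (i j : X.ι) :
    (X.ext f).imgOf ((X.ext f).dom j) i =
      {p | ∃ q, Sum.elim p q ∈ extSet f (X.transGraph i j)} :=
  (imgOf_dom_eq (X := X.ext f) i j).trans
    (Set.ext fun _ => exists_congr fun _ => hX.elim_mem_transGraph_ext)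

/-- The extension `D(S)` of a definable subset `D`. -/
def extSubset (f : M ↪ₑ[L] S) (D : Set X.carrier) : Set (X.ext f).carrier :=
  {a | ∃ (i : X.ι) (p : extSet f (X.img i)), p.1 ∈ extSet f (X.imgOf D i) ∧ a = extMk f X i p}

theorem IsDefinableSpace.extMk_mem_extSubset {D : Set X.carrier} (hD : X.IsDefSubset L D)
    {i : X.ι} {p : extSet f (X.img i)} :
    extMk f X i p ∈ extSubset f D ↔ p.1 ∈ extSet f (X.imgOf D i) := by
  constructor
  · rintro ⟨j, q, hq, h⟩
    exact hX.ext_mem_imgOf hD _ _ (hX.extMk_eq_iff.1 h.symm) hq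
  · exact fun h => ⟨i, p, h, rfl⟩

theorem IsDefinableSpace.imgOf_extSubset {D : Set X.carrier} (hD : X.IsDefSubset L D) (i : X.ι) :
    (X.ext f).imgOf (extSubset f D) i = extSet f (X.imgOf D i) := by
  ext p
  constructor
  · rintro ⟨⟨_, q, rfl⟩, h, rfl⟩
    exact Eq.mpr (congrArg (· ∈ _) (hX.chart_ext (p := q) rfl ⟨q, rfl⟩))
      ((hX.extMk_mem_extSubset hD).1 h)
  · intro hp
    have hp' := hX.ext_imgOf_subset hD p hp
    exact ⟨⟨_, ⟨p, hp'⟩, rfl⟩, (hX.extMk_mem_extSubset hD).2 hp,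
      hX.chart_ext (p := ⟨p, hp'⟩) rfl _⟩

theorem IsDefinableSpace.extSubset_subset_dom {D : Set X.carrier} (hD : X.IsDefSubset L D)
    {i : X.ι} (hDi : D ⊆ X.dom i) : extSubset f D ⊆ (X.ext f).dom i := by
  rintro _ ⟨j, p, hp, rfl⟩
  have h : ∀ p, p ∈ X.imgOf D j → ∃ q, Sum.elim p q ∈ X.transGraph j i := by
    rintro _ ⟨⟨a, ha⟩, haD, rfl⟩
    exact ⟨_, a, ha, hDi haD, rfl⟩
  have key : ∀ p, p ∈ extSet f (X.imgOf D j) →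
      ∃ q, Sum.elim p q ∈ extSet f (X.transGraph j i) := by
    refine (Transfers.forall_iff (f := f) ?_).1 h
    exact .imp (transfers_extSet (hD j)) (.ex (.mem_elim _ _ (hX.transfers_transGraph j i)))
  obtain ⟨q, hq⟩ := key p.1 hp
  have hq' := hX.ext_mem_img _ _ (hX.ext_symm _ _ hq)
  exact ⟨⟨q, hq'⟩, (hX.extMk_eq_iff.2 hq).symm⟩

/-- Finiteness of the cover turns "some `C k` contains the point" into a finite disjunction, which
transfers. -/
theorem IsDefinableSpace.iUnion_extSubset {κ : Type*} [Finite κ] {C : κ → Set X.carrier}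
    (hC : ∀ k, X.IsDefSubset L (C k)) (hCX : ⋃ k, C k = Set.univ) :
    ⋃ k, extSubset f (C k) = Set.univ := by
  refine Set.eq_univ_of_forall ?_
  rintro ⟨i, p⟩
  have h : ∀ p, p ∈ X.img i → ∃ k, p ∈ X.imgOf (C k) i := by
    rintro _ ⟨⟨a, ha⟩, rfl⟩
    obtain ⟨k, hk⟩ := Set.mem_iUnion.1 (hCX.symm ▸ Set.mem_univ a)
    exact ⟨k, _, hk, rfl⟩
  have key : ∀ p, p ∈ extSet f (X.img i) → ∃ k, p ∈ extSet f (X.imgOf (C k) i) := by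
    refine (Transfers.forall_iff (f := f) ?_).1 h
    exact .imp (hX.transfers_img i) (.exists_index fun k => transfers_extSet (hC k i))
  obtain ⟨k, hk⟩ := key p.1 p.2
  exact Set.mem_iUnion.2 ⟨k, i, p, hk, rfl⟩

theorem IsDefinableSpace.elim_mem_extSet_transGraph_restrict {D : Set X.carrier} (hD : X.IsDefSubset L D)
    {i j : X.ι} {p : Fin (X.dim i) → S} {q : Fin (X.dim j) → S} :
    Sum.elim p q ∈ extSet f ((X.restrict D).transGraph i j) ↔
      Sum.elim p q ∈ extSet f (X.transGraph i j) ∧ p ∈ extSet f (X.imgOf D i) := by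
  have h : ∀ p q, Sum.elim p q ∈ (X.pullback (Subtype.val : D → X.carrier)).transGraph i j ↔
      Sum.elim p q ∈ X.transGraph i j ∧ p ∈ X.imgOf D i := by
    intro p q
    rw [transGraph_pullback hX.inj, Subtype.range_coe]
    rfl
  have hdef : DefSet L ((X.pullback (Subtype.val : D → X.carrier)).transGraph i j) := by
    rw [transGraph_pullback hX.inj, Subtype.range_coe]
    exact defSet_of_transfers (.and (hX.trans_def i j).transfers (.mem _ (hD i).transfers))
  have key : ∀ p q, Sum.elim p q ∈
      extSet f ((X.pullback (Subtype.val : D → X.carrier)).transGraph i j) ↔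
      Sum.elim p q ∈ extSet f (X.transGraph i j) ∧ p ∈ extSet f (X.imgOf D i) := by
    refine (Transfers.forall_iff (f := f) ?_).1 h
    exact .all (.iff (.mem_elim _ _ (transfers_extSet hdef))
      (.and (.mem_elim _ _ (hX.transfers_transGraph i j)) (.mem _ (transfers_extSet (hD i)))))
  exact key p q

omit [TopologicalSpace M] hX in
theorem img_restrict (D : Set X.carrier) (i : X.ι) : (X.restrict D).img i = X.imgOf D i := by
  have := img_pullback (g := (Subtype.val : D → X.carrier)) i
  rwa [Subtype.range_coe] at this

/-- The canonical map `D(S) → X(S)`. -/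
def extInclusion (f : M ↪ₑ[L] S) {D : Set X.carrier} (hD : X.IsDefSubset L D) :
    ((X.restrict D).ext f).carrier → (X.ext f).carrier :=
  Quot.lift (fun a => extMk f X a.1 ⟨a.2.1, hX.ext_imgOf_subset hD _
    (img_restrict D a.1 ▸ a.2.2)⟩) fun _ _ h =>
      hX.extMk_eq_iff.2 ((hX.elim_mem_extSet_transGraph_restrict hD).1 h).1

theorem extInclusion_injective {D : Set X.carrier} (hD : X.IsDefSubset L D) :
    Function.Injective (extInclusion hX f hD) := by
  rintro ⟨⟨i, p⟩⟩ ⟨⟨j, q⟩⟩ h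
  exact Quot.sound ((hX.elim_mem_extSet_transGraph_restrict hD).2
    ⟨hX.extMk_eq_iff.1 h, img_restrict D i ▸ p.2⟩)

theorem range_extInclusion {D : Set X.carrier} (hD : X.IsDefSubset L D) :
    Set.range (extInclusion hX f hD) = extSubset f D := by
  ext a
  constructor
  · rintro ⟨⟨⟨i, p⟩⟩, rfl⟩
    exact ⟨i, _, img_restrict D i ▸ p.2, rfl⟩
  · rintro ⟨i, p, hp, rfl⟩
    exact ⟨extMk f (X.restrict D) i ⟨p.1, (img_restrict D i).symm ▸ hp⟩, rfl⟩

end Gluing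

/-- Extending commutes with restricting, as both sides are glued from the same sets along the same
graphs. Equality of charted sets lets the hypothesis on the extended piece be used for a subspace of
`X(S)`. -/
theorem IsDefinableSpace.ext_restrict_eq_pullback [LinearOrder M] [NoMinOrder M] [NoMaxOrder M]
    [TopologicalSpace M] [OrderTopology M] (hX : X.IsDefinableSpace L) {D : Set X.carrier}
    (hD : X.IsDefSubset L D) :
    (X.restrict D).ext f = (X.ext f).pullback (extInclusion hX f hD) := by
  have hP : (X.restrict D).IsDefinableSpace L :=
    hX.pullback Subtype.val_injective (by simpa using hD)
  refine mk_eq_pullback (Z := X.ext f) (extInclusion hX f hD) ((X.restrict D).ext f).dom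
    ((X.restrict D).ext f).chart (fun i a => ⟨?_, ?_⟩) ?_
  · rintro ⟨p, rfl⟩
    exact ⟨_, rfl⟩
  · rintro ⟨p, hp⟩
    obtain ⟨⟨j, q⟩⟩ := a
    have h := hX.extMk_eq_iff.1 hp
    have hp' : p.1 ∈ extSet f (X.imgOf D i) :=
      hX.ext_mem_imgOf hD _ _ (hX.ext_symm _ _ h) (img_restrict D j ▸ q.2)
    exact ⟨⟨p.1, (img_restrict D i).symm ▸ hp'⟩,
      Quot.sound ((hX.elim_mem_extSet_transGraph_restrict hD).2 ⟨h, hp'⟩)⟩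
  · rintro i _ ⟨p, rfl⟩ h'
    exact (hP.chart_ext rfl _).trans (hX.chart_ext rfl h').symm

section

variable [L.IsOrdered] [LinearOrder M] [L.OrderedStructure M] [NoMinOrder M] [NoMaxOrder M]
  [LinearOrder S] [L.OrderedStructure S]

omit [NoMaxOrder M] in
theorem _root_.OMin.noMinOrder_of_elementaryEmbedding (f : M ↪ₑ[L] S) : NoMinOrder S :=
  ⟨(Transfers.sentence_iff (f := f) (.all_one (.ex_one (.lt _ _)))).1
    fun a : M => exists_lt a⟩

omit [NoMinOrder M] in
theorem _root_.OMin.noMaxOrder_of_elementaryEmbedding (f : M ↪ₑ[L] S) : NoMaxOrder S :=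
  ⟨(Transfers.sentence_iff (f := f) (.all_one (.ex_one (.lt _ _)))).1
    fun a : M => exists_gt a⟩

variable [TopologicalSpace M] [OrderTopology M] [TopologicalSpace S] [OrderTopology S]
  [NoMinOrder S] [NoMaxOrder S]

theorem IsDefinableSpace.ext (hX : X.IsDefinableSpace L) : (X.ext f).IsDefinableSpace L := by
  refine isDefinableSpace_of_graphs ?_ ?_ ?_ ?_ ?_ ?_
  · rintro ⟨i, p⟩
    exact ⟨i, p, rfl⟩
  · rintro i ⟨_, p, rfl⟩ ⟨_, q, rfl⟩ h
    have h' : p.1 = q.1 := (hX.chart_ext rfl _).symm.trans (h.trans (hX.chart_ext rfl _))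
    obtain rfl := Subtype.ext h'
    rfl
  · intro (i : X.ι)
    rw [hX.img_ext]
    exact (hX.transfers_img i).defSet_right
  · intro (i : X.ι) (j : X.ι)
    rw [hX.transGraph_ext]
    exact (hX.transfers_transGraph i j).defSet_right
  · intro (i : X.ι) (j : X.ι)
    have := hX.openIn_overlap i j
    rw [imgOf_dom_eq] at this
    refine Eq.mpr (congrArg₂ OpenIn (hX.img_ext i) (hX.imgOf_dom_ext i j)) ?_
    exact (Transfers.openIn_iff (hX.transfers_img i)
      (.ex (.mem_elim _ _ (hX.transfers_transGraph i j)))).1 this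
  · intro (i : X.ι) (j : X.ι)
    rw [hX.transGraph_ext]
    exact (Transfers.contGraph_iff (hX.transfers_transGraph i j)).1 (hX.contGraph i j)

theorem DefOpen.compl_extSubset (hX : X.IsDefinableSpace L) {C : Set X.carrier}
    (hC : X.DefOpen L Cᶜ) : (X.ext f).DefOpen L (extSubset f C)ᶜ := by
  have hCd : X.IsDefSubset L C := by simpa using hC.1.compl hX
  have hXS : (X.ext f).IsDefinableSpace L := hX.ext
  refine ⟨IsDefSubset.compl hXS fun (i : X.ι) => ?_, (isOpen_iff_openIn hXS.inj _).2 fun (i : X.ι) => ?_⟩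
  · rw [hX.imgOf_extSubset hCd]
    exact (transfers_extSet (hCd i)).defSet_right
  · have := (isOpen_iff_openIn hX.inj _).1 hC.2 i
    rw [imgOf_compl hX.inj] at this
    refine Eq.mpr (congrArg₂ OpenIn (hX.img_ext i) ((imgOf_compl hXS.inj (extSubset f C) i).trans
      (congrArg₂ (· \ ·) (hX.img_ext i) (hX.imgOf_extSubset hCd i)))) ?_
    exact (Transfers.openIn_iff (f := f) (hX.transfers_img i)
      (.and (hX.transfers_img i) (.not (transfers_extSet (hCd i))))).1 this

/-- Normality of `X(S)` can be tested on the extensions of the members of a closed cover. -/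
theorem IsDefinableSpace.ext_isDefinablyNormal (hX : X.IsDefinableSpace L) {κ : Type*}
    [Finite κ] {C : κ → Set X.carrier} (hC : ∀ k, X.DefOpen L (C k)ᶜ)
    (hCX : ⋃ k, C k = Set.univ)
    (h : ∀ k, SepNormal (((X.restrict (C k)).ext f).DefOpen L)) :
    (X.ext f).IsDefinablyNormal L := by
  have hCd : ∀ k, X.IsDefSubset L (C k) := fun k => by simpa using (hC k).1.compl hX
  have hXS : (X.ext f).IsDefinableSpace L := hX.ext
  refine hXS.isDefinablyNormal_of_closed_cover
    (fun k => extInclusion hX f (hCd k)) (fun k => extInclusion_injective hX (hCd k))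
    (fun k => ?_) (fun a => ?_) fun k => ?_
  · rw [range_extInclusion]
    exact (hC k).compl_extSubset hX
  · obtain ⟨k, hk⟩ := Set.mem_iUnion.1
      ((hX.iUnion_extSubset (f := f) hCd hCX).symm ▸ Set.mem_univ a)
    rw [← range_extInclusion hX (hCd k)] at hk
    exact ⟨k, hk⟩
  · have e := hX.ext_restrict_eq_pullback (f := f) (hCd k)
    exact e ▸ h k

end

end ChartedSet

/-! ### Expansions of the language. -/

theorem IsGauge.map_expansion {L : FirstOrder.Language.{u, v}} {L' : FirstOrder.Language.{u', v'}}
    {M : Type w} [L.Structure M] [L'.Structure M] [LinearOrder M] (φ : L →ᴸ L')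
    [φ.IsExpansionOn M] {E : Set (Fin 3 → M)} (h : IsGauge L E) : IsGauge L' E :=
  ⟨h.nonempty, h.definable.map_expansion φ, h.isOpen, h.mono, h.small, h.refl⟩

namespace ChartedSet

variable {L : FirstOrder.Language.{u, v}} {L' : FirstOrder.Language.{u', v'}} {M : Type w}
  [L.Structure M] [L'.Structure M] [TopologicalSpace M] {X : ChartedSet.{w, x} M}

theorem IsDefinableSpace.map_expansion (φ : L →ᴸ L') [φ.IsExpansionOn M]
    (hX : X.IsDefinableSpace L) : X.IsDefinableSpace L' where
  cover := hX.cover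
  inj := hX.inj
  img_def i := (hX.img_def i).map_expansion φ
  overlap_def i j := (hX.overlap_def i j).map_expansion φ
  overlap_open := hX.overlap_open
  trans_def i j := (hX.trans_def i j).map_expansion φ
  trans_homeo := hX.trans_homeo

theorem DefOpen.map_expansion (φ : L →ᴸ L') [φ.IsExpansionOn M] {U : Set X.carrier}
    (hU : X.DefOpen L U) : X.DefOpen L' U :=
  ⟨fun i => (hU.1 i).map_expansion φ, hU.2⟩

end ChartedSet

end OMin

/-! ### The main theorem. -/

theorem mainTheorem11 {L : FirstOrder.Language.{u, v}} [L.IsOrdered] {M : Type w} [L.Structure M]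
    [LinearOrder M] [L.OrderedStructure M] [DenselyOrdered M] [NoMinOrder M] [NoMaxOrder M]
    [TopologicalSpace M] [OrderTopology M] (hM : OMin.IsOMinimal L M)
    (X : OMin.ChartedSet.{w, x} M) (Y : OMin.ChartedSet.{w, y} M)
    (hX : X.IsDefinablyNormal L) (hY : Y.IsDefinablyNormal L) :
    -- the three properties are affine on `(X, Y)`
    (OMin.ChartedSet.AffineOn L X Y (fun C D => (C.prod D).IsDefinablyNormal L) ∧
      OMin.ChartedSet.AffineOn L X Y (fun C _ => C.IsCompletelyDefinablyNormal L) ∧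
      -- for an elementary extension `S` of `M`
      (∀ {S : Type w'} [L.Structure S] [LinearOrder S] [L.OrderedStructure S]
        [TopologicalSpace S] [OrderTopology S] (f : M ↪ₑ[L] S),
        OMin.ChartedSet.AffineOn L X Y (fun _ D => (D.ext f).IsDefinablyNormal L)) ∧
      -- for an o-minimal expansion of `M`, given by an `L'`-structure on the same set
      (∀ {L' : FirstOrder.Language.{u', v'}} [L'.Structure M] (φ : L →ᴸ L') [φ.IsExpansionOn M],
        OMin.IsOMinimal L' M →
        OMin.ChartedSet.AffineOn L X Y (fun _ D => D.IsDefinablyNormal L'))) ∧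
    -- all three properties hold if `M` expands an ordered group
    (OMin.ExpandsOrderedGroup L M →
      (X.prod Y).IsDefinablyNormal L ∧
      X.IsCompletelyDefinablyNormal L ∧
      (∀ {S : Type w'} [L.Structure S] [LinearOrder S] [L.OrderedStructure S]
        [TopologicalSpace S] [OrderTopology S] (f : M ↪ₑ[L] S),
        (X.ext f).IsDefinablyNormal L) ∧
      (∀ {L' : FirstOrder.Language.{u', v'}} [L'.Structure M] (φ : L →ᴸ L') [φ.IsExpansionOn M],
        OMin.IsOMinimal L' M → X.IsDefinablyNormal L')) := by
  have hXd := hX.1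
  have hYd := hY.1
  have := X.fin
  have := Y.fin
  -- The closed shrinkings of the two atlases supply the covers for all the claims.
  obtain ⟨C, hC, hCi, hCX⟩ := hX.exists_shrinking
  obtain ⟨D, hD, hDi, hDY⟩ := hY.exists_shrinking
  have hCa := fun i => hXd.isClosedAffine (hC i) (hCi i)
  have hDa := fun i => hYd.isClosedAffine (hD i) (hDi i)
  refine ⟨⟨fun h => ?_, fun h => ⟨hXd, fun Z hZ => ?_⟩, fun f h => ?_, fun φ _ _ h => ?_⟩,
    fun hG => ?_⟩
  · exact hXd.prod_isDefinablyNormal hYd hC hD hCX hDY fun i j =>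
      (OMin.ChartedSet.isDefinablyNormal_iff.1 (h _ _ (hCa i) (hDa j))).2
  · exact hXd.restrict_isDefinablyNormal hC hCX hZ fun i =>
      (OMin.ChartedSet.isDefinablyNormal_iff.1 ((h _ _ (hCa i)
        OMin.ChartedSet.isClosedAffine_empty).2 _ ((hCa i).1.restrict hXd hZ))).2
  · have := OMin.noMinOrder_of_elementaryEmbedding f
    have := OMin.noMaxOrder_of_elementaryEmbedding f
    exact hYd.ext_isDefinablyNormal hD hDY fun i =>
      (OMin.ChartedSet.isDefinablyNormal_iff.1
        (h _ _ OMin.ChartedSet.isClosedAffine_empty (hDa i))).2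
  -- The shrinking comes from normality over `L`; it remains a closed definable cover over `L'`.
  · refine (hYd.map_expansion φ).isDefinablyNormal_of_closed_cover (c := fun i => D i)
      (fun i => Subtype.val) (fun i => Subtype.val_injective)
      (fun i => by simpa using (hD i).map_expansion φ) (fun a => ?_) fun i =>
      (OMin.ChartedSet.isDefinablyNormal_iff.1
        (h _ _ OMin.ChartedSet.isClosedAffine_empty (hDa i))).2
    obtain ⟨i, hi⟩ := Set.mem_iUnion.1 (hDY.symm ▸ Set.mem_univ a)
    exact ⟨i, ⟨a, hi⟩, rfl⟩
  · obtain ⟨E, hE⟩ := hG.exists_isGauge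
    refine ⟨?_, ⟨hXd, fun Z hZ => ?_⟩, fun f => ?_, fun φ _ _ => ?_⟩
    -- The product of two shrinkings is a shrinking of the product atlas.
    · refine (hXd.prod hYd).isDefinablyNormal_of_isGauge hE (C := fun k => C k.1 ×ˢ D k.2)
        (fun k => .compl_prod hXd hYd (hC _) (hD _))
        (fun k => Set.prod_mono (hCi k.1) (hDi k.2)) (Set.eq_univ_of_forall ?_)
      rintro ⟨a, b⟩
      obtain ⟨i, hi⟩ := Set.mem_iUnion.1 (hCX.symm ▸ Set.mem_univ a)
      obtain ⟨j, hj⟩ := Set.mem_iUnion.1 (hDY.symm ▸ Set.mem_univ b)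
      exact Set.mem_iUnion.2 ⟨(i, j), hi, hj⟩
    · have hR : X.IsDefSubset L (Set.range (Subtype.val : Z → X.carrier)) := by simpa using hZ
      refine (hXd.pullback Subtype.val_injective hR).isDefinablyNormal_of_isGauge hE
        (C := fun i => Subtype.val ⁻¹' C i)
        (fun i => (hC i).preimage hXd Subtype.val_injective hR)
        (fun i => Set.preimage_mono (hCi i)) (Set.eq_univ_of_forall fun a => ?_)
      obtain ⟨i, hi⟩ := Set.mem_iUnion.1 (hCX.symm ▸ Set.mem_univ a.1)
      exact Set.mem_iUnion.2 ⟨i, hi⟩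
    · have := OMin.noMinOrder_of_elementaryEmbedding f
      have := OMin.noMaxOrder_of_elementaryEmbedding f
      -- Both the gauge and the shrinking are taken from `M` and extended to `S`.
      exact OMin.ChartedSet.IsDefinableSpace.isDefinablyNormal_of_isGauge (hE.transfer f)
        hXd.ext (C := fun i => OMin.ChartedSet.extSubset f (C i))
        (fun i => (hC i).compl_extSubset hXd)
        (fun i => hXd.extSubset_subset_dom (hCa i).1 (hCi i))
        (hXd.iUnion_extSubset (κ := X.ι) (fun i => (hCa i).1) hCX)
    · exact (hXd.map_expansion φ).isDefinablyNormal_of_isGauge (hE.map_expansion φ)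
        (fun i => (hC i).map_expansion φ) hCi hCX
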